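/- Let $\mathbb{F}_q$ be a finite field of characteristic different from $2$ and $3$, and let $E: y^2=f(x)$ be an elliptic curve over $\mathbb{F}_q$, with $f$ a separable cubic polynomial and point at infinity $P_\infty$. Let $L\ge 1$ be odd, $J=(L+1)/2$, let $X,T\ge 0$ be integers, let $Z$ be the number of rational zeros of $y$ on $E$, and suppose $$\#E(\mathbb{F}_q)\ \ge\ 2L+X+T+11+Z .$$ Put $N=L+X+T+8$. For a divisor $D$ let $\mathcal{L}(D)=\{g\in\mathbb{F}_q(E)^* : (g)+D\ge 0\}\cup\{0\}$. Then there are rational affine points $P_j=(\alpha_j,\beta_j)$, $\bar P_j=(\alpha_j,-\beta_j)$, $j=1,\dots,J$, with $\beta_j\ne 0$ and distinct $\alpha_j$. For every choice of such points put $h=\prod_{j=1}^{J}(x-\alpha_j)^{-1}$ and $$h_j^{(1)}=h\prod_{j'\in[J]\setminus j}(x-\alpha_{j'})\ (1\le j\le J),\qquad h_j^{(2)}=h\,y\prod_{j'\in[J-1]\setminus j}(x-\alpha_{j'})\ (1\le j\le J-1),$$ and denote these $L$ functions by $h_1,\dots,h_L$. Then $h_1,\dots,h_L$ is a basis of $\mathcal{L}\bigl(\sum_j(P_j+\bar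 P_j)-P_\infty\bigr)$, and there are $N$ distinct rational affine points $R_1,\dots,R_N$, different from all $P_j,\bar P_j$ and from the zeros of $y$, with the following properties. Let $A$ be the algebra of rational functions regular at $R_1,\dots,R_N$, and $\varphi:A\to\mathbb{F}_q^N$, $\varphi(g)=(g(R_1),\dots,g(R_N))$. Let $$D_\ell^{\mathrm{sec}}=(X+1)P_\infty+(h_\ell),\qquad D^{\mathrm{priv}}=(T+1)P_\infty .$$ Every $h_\ell$ is a unit of $A$; $\mathcal{L}(0)=\mathbb{F}_q$; $\mathcal{L}(-(h_\ell))=\mathrm{span}\{h_\ell\}$; and $\mathcal{L}(D_\ell^{\mathrm{sec}})$ and $\mathcal{L}(D^{\mathrm{priv}})$ are contained in $A$ and have dimension $X+1$ and $T+1$. For every number $M$ of files, the following is an $X$-secure and $T$-private information retrieval scheme with $N$ servers. A file is a vector of $L$ symbols of $\mathbb{F}_q$; write $w_{\ell,m}$ for symbol $\ell$ of file $m$. With independent uniformly random $f_{\ell,m}\in\mathcal{L}(D_\ell^{\mathrm{sec}})$ and $g_{\ell,m}\in\mathcal{L}(D^{\mathrm{priv}})$, server $n$ stores the values at $R_n$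 of the functions $s_{\ell,m}=w_{\ell,m}+f_{\ell,m}$; a user who wants file $\theta$ sends to server $n$ the values at $R_n$ of the functions $q_{\ell,m}=\delta_{m,\theta}h_\ell+g_{\ell,m}$; and server $n$ returns the symbol $\sum_{\ell,m}s_{\ell,m}(R_n)\,q_{\ell,m}(R_n)$. That is: * (correctness) file $\theta$ is determined by $\theta$, the queries and the $N$ answers; * ($X$-security) the joint distribution of the data stored by any set of at most $X$ servers does not depend on the files; * ($T$-privacy) for all contents of the files, the joint distribution of the stored data, queries and answers seen by any set of at most $T$ servers does not depend on $\theta$. Its rate, the size of a file divided by the total size of the downloaded answers, is $$\mathcal{R}=\frac{L}{N}=1-\frac{X+T+8}{N}.$$ -/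

import Mathlib

universe u

noncomputable section

/-- An elliptic curve `y² = f(x)` over a field of characteristic different from `2` and `3`:
`f` is a cubic polynomial (with arbitrary nonzero leading coefficient), and separability of `f` is
smoothness of the curve. Its only point outside the affine plane is `P∞ = [0 : 1 : 0]`. -/
structure EllipticCurve (F : Type u) [Field F] where
  f : Polynomial F
  natDegree_f : f.natDegree = 3
  separable_f : f.Separable
  ringChar_ne_two : ringChar F ≠ 2
  ringChar_ne_three : ringChar F ≠ 3

namespace EllipticCurve

open Polynomial IsDedekindDomain

open scoped WithZero nonZeroDivisors

variable {F : Type u} [Field F] (E : EllipticCurve F)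

/-- The polynomial `Y² - f(X)` in `F[X][Y]`. -/
def poly : F[X][X] := X ^ 2 - C E.f

/-- The affine coordinate ring `F[x, y] = F[X, Y] / (Y² - f(X))`. -/
abbrev CoordRing : Type u := AdjoinRoot E.poly

/-- The function `y`. -/
def y : E.CoordRing := AdjoinRoot.root E.poly

/-- The function `x`. -/
def x : E.CoordRing := algebraMap F[X] E.CoordRing X

theorem monic_poly : E.poly.Monic := monic_X_pow_sub_C E.f two_ne_zero

theorem natDegree_poly : E.poly.natDegree = 2 := natDegree_X_pow_sub_C

theorem f_ne_zero : E.f ≠ 0 := fun h => by simpa [h] using E.natDegree_f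

theorem degree_f : E.f.degree = 3 := by
  rw [degree_eq_natDegree E.f_ne_zero, E.natDegree_f]; rfl

theorem prime_poly : Prime E.poly := by
  rw [← irreducible_iff_prime]
  by_contra h
  obtain ⟨a, b, h0, h1⟩ :=
    (E.monic_poly.not_irreducible_iff_exists_add_mul_eq_coeff E.natDegree_poly).mp h
  have e0 : E.poly.coeff 0 = -E.f := by simp [poly, coeff_X_pow]
  have e1 : E.poly.coeff 1 = 0 := by simp [poly, coeff_X_pow]
  rw [e0] at h0
  rw [e1] at h1
  have hb : b = -a := by linear_combination -h1
  have hf : E.f = a ^ 2 := by rw [hb] at h0; linear_combination -h0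
  have := E.natDegree_f
  rw [hf, natDegree_pow] at this
  omega

instance : IsDomain E.CoordRing := AdjoinRoot.isDomain_of_prime E.prime_poly

instance : Module.Finite F[X] E.CoordRing := E.monic_poly.finite_adjoinRoot

/-- The basis `1, y` of `F[x, y]` over `F[x]`. -/
def basis : Module.Basis (Fin 2) F[X] E.CoordRing :=
  (AdjoinRoot.powerBasis' E.monic_poly).basis.reindex (finCongr E.natDegree_poly)

instance : Module.Free F[X] E.CoordRing := .of_basis E.basis

theorem basis_zero : E.basis 0 = 1 := by
  rw [basis, Module.Basis.reindex_apply, PowerBasis.basis_eq_pow]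
  exact pow_zero _

theorem basis_one : E.basis 1 = E.y := by
  rw [basis, Module.Basis.reindex_apply, PowerBasis.basis_eq_pow]
  exact pow_one _

theorem y_sq : E.y ^ 2 = algebraMap F[X] E.CoordRing E.f := by
  have h : AdjoinRoot.mk E.poly (X ^ 2 - C E.f) = 0 := AdjoinRoot.mk_self
  rw [map_sub, map_pow, AdjoinRoot.mk_X, AdjoinRoot.mk_C] at h
  exact sub_eq_zero.mp h

theorem exists_repr (w : E.CoordRing) : ∃ p q : F[X], w = p • 1 + q • E.y := by
  refine ⟨E.basis.repr w 0, E.basis.repr w 1, ?_⟩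
  conv_lhs => rw [← E.basis.sum_repr w]
  rw [Fin.sum_univ_two, basis_zero, basis_one]

theorem norm_repr (p q : F[X]) :
    Algebra.norm F[X] (p • (1 : E.CoordRing) + q • E.y) = p ^ 2 - q ^ 2 * E.f := by
  have h : (p • (1 : E.CoordRing) + q • E.y) * E.y = (q * E.f) • 1 + p • E.y := by
    rw [add_mul, smul_mul_assoc, smul_mul_assoc, ← pow_two, y_sq, one_mul, mul_smul,
      ← Algebra.algebraMap_eq_smul_one E.f, add_comm]
  simp_rw [Algebra.norm_eq_matrix_det E.basis, Matrix.det_fin_two,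
    Algebra.leftMulMatrix_eq_repr_mul, basis_zero, mul_one, basis_one, h, map_add,
    Finsupp.add_apply, map_smul, Finsupp.smul_apply, ← basis_zero, ← basis_one,
    Module.Basis.repr_self_apply, if_pos, one_ne_zero, if_false, smul_eq_mul]
  simp
  ring1

theorem degree_norm_repr (p q : F[X]) :
    (Algebra.norm F[X] (p • (1 : E.CoordRing) + q • E.y)).degree =
      max (2 • p.degree) (2 • q.degree + 3) := by
  rw [norm_repr]
  have hp' : (p ^ 2).degree = 2 • p.degree := degree_pow p 2
  have hq' : (q ^ 2 * E.f).degree = 2 • q.degree + 3 := by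
    rw [degree_mul, degree_pow, degree_f]
  rw [← hp', ← hq']
  by_cases hp : p = 0
  · simp [hp]
  by_cases hq : q = 0
  · simp [hq]
  have hne : (p ^ 2).degree ≠ (q ^ 2 * E.f).degree := by
    intro h
    have h' := natDegree_eq_of_degree_eq h
    rw [natDegree_pow, natDegree_mul (pow_ne_zero 2 hq) E.f_ne_zero, natDegree_pow,
      E.natDegree_f] at h'
    omega
  rcases lt_or_gt_of_ne hne with h | h
  · rw [degree_sub_eq_right_of_degree_lt h, max_eq_right h.le]
  · rw [degree_sub_eq_left_of_degree_lt h, max_eq_left h.le]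

theorem degree_norm_add_le (u v : E.CoordRing) :
    (Algebra.norm F[X] (u + v)).degree ≤
      max (Algebra.norm F[X] u).degree (Algebra.norm F[X] v).degree := by
  obtain ⟨p, q, rfl⟩ := E.exists_repr u
  obtain ⟨r, s, rfl⟩ := E.exists_repr v
  have h : p • (1 : E.CoordRing) + q • E.y + (r • 1 + s • E.y) = (p + r) • 1 + (q + s) • E.y := by
    rw [add_smul, add_smul]; abel
  rw [h]
  simp only [degree_norm_repr]
  have h1 := degree_add_le p r
  have h2 := degree_add_le q s
  rcases le_max_iff.mp h1 with h1 | h1 <;> rcases le_max_iff.mp h2 with h2 | h2 <;>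
    refine max_le ?_ ?_ <;> grw [‹degree _ ≤ _›] <;> simp

theorem norm_ne_zero {u : E.CoordRing} (hu : u ≠ 0) : Algebra.norm F[X] u ≠ 0 :=
  Algebra.norm_ne_zero_iff.mpr hu

open scoped Classical in
/-- The pole order at `P∞` on the coordinate ring, written multiplicatively. The norm of `p + q y`
is `p² - q² f`, so the pole order of `p + q y` is `max (2 deg p) (2 deg q + 3)`; in particular `x`
has a pole of order `2` and `y` a pole of order `3`. -/
def valInfRing : Valuation E.CoordRing ℤᵐ⁰ where
  toFun u := if u = 0 then 0 else WithZero.exp ((Algebra.norm F[X] u).natDegree : ℤ)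
  map_zero' := by simp
  map_one' := by simp
  map_mul' u v := by
    by_cases hu : u = 0
    · simp [hu]
    by_cases hv : v = 0
    · simp [hv]
    rw [if_neg hu, if_neg hv, if_neg (mul_ne_zero hu hv), map_mul,
      natDegree_mul (E.norm_ne_zero hu) (E.norm_ne_zero hv), Nat.cast_add, WithZero.exp_add]
  map_add_le_max' u v := by
    by_cases huv : u + v = 0
    · simp [huv]
    by_cases hu : u = 0
    · simp [hu]
    by_cases hv : v = 0
    · simp [hv]
    rw [if_neg hu, if_neg hv, if_neg huv, le_max_iff, WithZero.exp_le_exp, WithZero.exp_le_exp,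
      Nat.cast_le, Nat.cast_le]
    rcases le_max_iff.mp (E.degree_norm_add_le u v) with h | h
    · exact Or.inl (natDegree_le_natDegree h)
    · exact Or.inr (natDegree_le_natDegree h)

theorem two_ne_zero_field (E : EllipticCurve F) : (2 : F) ≠ 0 := by
  intro h
  have := CharTwo.of_one_ne_zero_of_two_eq_zero one_ne_zero h
  exact E.ringChar_ne_two (ringChar.eq F 2)

/-- The involution `y ↦ -y`, used to prove that `F[x, y]` is a Dedekind domain. -/
def conj : E.CoordRing →ₐ[F[X]] E.CoordRing :=
  AdjoinRoot.liftAlgHom E.poly (Algebra.ofId F[X] E.CoordRing) (-E.y) (by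
    change eval₂ _ _ (X ^ 2 - C E.f) = 0
    rw [eval₂_sub, eval₂_pow, eval₂_X, eval₂_C, neg_sq, y_sq]
    exact sub_self _)

theorem conj_y : E.conj E.y = -E.y := by
  rw [conj]; exact AdjoinRoot.liftAlgHom_root ..

theorem conj_conj (u : E.CoordRing) : E.conj (E.conj u) = u := by
  obtain ⟨p, q, rfl⟩ := E.exists_repr u
  simp [conj_y]

theorem mul_conj (p q : F[X]) : (p • (1 : E.CoordRing) + q • E.y) * E.conj (p • 1 + q • E.y) =
    algebraMap F[X] E.CoordRing (p ^ 2 - q ^ 2 * E.f) := by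
  simp only [map_add, map_smul, map_one, conj_y]
  simp only [Algebra.smul_def, map_sub, map_mul, map_pow, ← y_sq]
  ring

/-- The function field `F(x, y)` of the curve. -/
abbrev FunField : Type u := FractionRing E.CoordRing

theorem algebraMap_injective : Function.Injective (algebraMap F[X] E.FunField) := by
  rw [IsScalarTower.algebraMap_eq F[X] E.CoordRing E.FunField]
  exact (IsFractionRing.injective E.CoordRing E.FunField).comp
    (FaithfulSMul.algebraMap_injective F[X] E.CoordRing)

theorem dvd_of_isIntegral {a d : F[X]} (hd : d ≠ 0)
    (h : IsIntegral F[X] (algebraMap F[X] E.FunField a / algebraMap F[X] E.FunField d)) :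
    d ∣ a := by
  have hinj : Function.Injective (Algebra.ofId F[X] E.FunField) := E.algebraMap_injective
  let φ : FractionRing F[X] →ₐ[F[X]] E.FunField := IsFractionRing.liftAlgHom hinj
  have hφ : Function.Injective φ := φ.toRingHom.injective
  have e : algebraMap F[X] E.FunField a / algebraMap F[X] E.FunField d =
      φ (algebraMap F[X] _ a / algebraMap F[X] _ d) := by
    rw [map_div₀, AlgHom.commutes, AlgHom.commutes]
  rw [e, isIntegral_algHom_iff φ hφ] at h
  obtain ⟨b, hb⟩ := IsIntegrallyClosed.isIntegral_iff.mp h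
  have hd' : algebraMap F[X] (FractionRing F[X]) d ≠ 0 := by simpa using hd
  rw [eq_div_iff hd', ← map_mul] at hb
  exact ⟨b, (IsFractionRing.injective F[X] (FractionRing F[X]) hb).symm.trans (mul_comm _ _)⟩

theorem dvd_of_sq_dvd {d q : F[X]} (h : d ^ 2 ∣ q ^ 2 * E.f) : d ∣ q := by
  by_cases hd : d = 0
  · subst hd
    have h0 : q ^ 2 * E.f = 0 := by simpa using h
    rcases mul_eq_zero.mp h0 with h | h
    · simp [pow_eq_zero_iff two_ne_zero |>.mp h]
    · exact absurd h E.f_ne_zero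
  classical
  have hg : EuclideanDomain.gcd d q ≠ 0 := fun h0 => hd (EuclideanDomain.gcd_eq_zero_iff.mp h0).1
  obtain ⟨d', h1⟩ := EuclideanDomain.gcd_dvd_left d q
  obtain ⟨q', h2⟩ := EuclideanDomain.gcd_dvd_right d q
  set g := EuclideanDomain.gcd d q with hgdef
  have hc : IsCoprime d' q' := by
    have hb : g = d * EuclideanDomain.gcdA d q + q * EuclideanDomain.gcdB d q :=
      EuclideanDomain.gcd_eq_gcd_ab d q
    refine ⟨EuclideanDomain.gcdA d q, EuclideanDomain.gcdB d q, mul_left_cancel₀ hg ?_⟩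
    calc _ = (g * d') * EuclideanDomain.gcdA d q + (g * q') * EuclideanDomain.gcdB d q := by ring
      _ = g * 1 := by rw [← h1, ← h2, mul_one]; exact hb.symm
  rw [h1, h2, mul_pow, mul_pow, mul_assoc, mul_dvd_mul_iff_left (pow_ne_zero 2 hg)] at h
  have hf : d' * d' ∣ E.f := by
    rw [← pow_two]
    exact (hc.pow (m := 2) (n := 2)).dvd_of_dvd_mul_left h
  have hu := E.separable_f.squarefree d' hf
  rw [h1, h2]
  exact mul_dvd_mul_left g hu.dvd

instance : IsIntegrallyClosed E.CoordRing := by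
  rw [isIntegrallyClosed_iff E.FunField]
  intro g hg
  replace hg : IsIntegral F[X] g := isIntegral_trans g hg
  have hinj : Function.Injective ((Algebra.ofId E.CoordRing E.FunField).restrictScalars F[X] |>.comp E.conj) := by
    refine (IsFractionRing.injective E.CoordRing E.FunField).comp ?_
    exact Function.LeftInverse.injective E.conj_conj
  let τ : E.FunField →ₐ[F[X]] E.FunField := IsFractionRing.liftAlgHom hinj
  have hτ (u : E.CoordRing) : τ (algebraMap _ _ u) = algebraMap _ _ (E.conj u) :=
    IsFractionRing.lift_algebraMap hinj u
  -- write `g = (p + q y) / d`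
  obtain ⟨p, q, d, hd, hgeq⟩ : ∃ p q d : F[X], d ≠ 0 ∧ g =
      algebraMap E.CoordRing E.FunField (p • 1 + q • E.y) / algebraMap F[X] E.FunField d := by
    obtain ⟨u, v, hv, rfl⟩ := IsFractionRing.div_surjective E.CoordRing g
    have hv0 : v ≠ 0 := nonZeroDivisors.ne_zero hv
    obtain ⟨p, q, h⟩ := E.exists_repr (u * E.conj v)
    obtain ⟨r, s, h'⟩ := E.exists_repr v
    have hc : E.conj v ≠ 0 := by
      rw [Ne, map_eq_zero_iff _ (Function.LeftInverse.injective E.conj_conj)]; exact hv0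
    have hm : v * E.conj v = algebraMap F[X] E.CoordRing (r ^ 2 - s ^ 2 * E.f) := by
      rw [h', mul_conj]
    refine ⟨p, q, r ^ 2 - s ^ 2 * E.f, ?_, ?_⟩
    · intro h0
      rw [h0, map_zero] at hm
      exact mul_ne_zero hv0 hc hm
    · rw [← h, IsScalarTower.algebraMap_apply F[X] E.CoordRing E.FunField, ← hm, map_mul, map_mul,
        mul_div_mul_right]
      simpa using hc
  subst hgeq
  set a := algebraMap F[X] E.FunField with ha
  set Y := algebraMap E.CoordRing E.FunField E.y with hY
  have hYsq : Y ^ 2 = a E.f := by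
    rw [hY, ← map_pow, y_sq, ha, IsScalarTower.algebraMap_apply F[X] E.CoordRing E.FunField]
  have hd0 : a d ≠ 0 := by
    rw [Ne, map_eq_zero_iff _ E.algebraMap_injective]; exact hd
  have e1 : algebraMap E.CoordRing E.FunField (p • 1 + q • E.y) = a p + a q * Y := by
    simp [Algebra.smul_def, ha, hY, IsScalarTower.algebraMap_apply F[X] E.CoordRing E.FunField]
  have e2 : τ (algebraMap E.CoordRing E.FunField (p • 1 + q • E.y) / a d) = (a p - a q * Y) / a d := by
    rw [map_div₀, hτ, ha, AlgHom.commutes]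
    simp only [map_add, map_smul, map_one, conj_y]
    simp [Algebra.smul_def, hY, IsScalarTower.algebraMap_apply F[X] E.CoordRing E.FunField,
      sub_eq_add_neg]
  have hg' := hg.map τ
  rw [e2] at hg'
  rw [e1] at hg ⊢
  have hp : d ∣ C 2 * p := by
    apply E.dvd_of_isIntegral hd
    have h := hg.add hg'
    have e : (a p + a q * Y) / a d + (a p - a q * Y) / a d = a (C 2 * p) / a d := by
      rw [map_mul, map_ofNat C 2, map_ofNat a 2]; ring
    rwa [e] at h
  have hq : d ^ 2 ∣ (C 2 * q) ^ 2 * E.f := by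
    apply E.dvd_of_isIntegral (pow_ne_zero 2 hd)
    have h := (hg.sub hg').pow 2
    have e : ((a p + a q * Y) / a d - (a p - a q * Y) / a d) ^ 2 =
        a ((C 2 * q) ^ 2 * E.f) / a (d ^ 2) := by
      rw [map_mul, map_pow, map_pow, map_mul, map_ofNat C 2, map_ofNat a 2, ← hYsq]; ring
    rwa [e] at h
  have h2 : IsUnit (C (2 : F)) := isUnit_C.mpr E.two_ne_zero_field.isUnit
  rw [h2.dvd_mul_left] at hp
  replace hq := E.dvd_of_sq_dvd hq
  rw [h2.dvd_mul_left] at hq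
  obtain ⟨p', rfl⟩ := hp
  obtain ⟨q', rfl⟩ := hq
  refine ⟨p' • 1 + q' • E.y, ?_⟩
  rw [eq_div_iff hd0]
  simp [Algebra.smul_def, ha, hY, IsScalarTower.algebraMap_apply F[X] E.CoordRing E.FunField]
  ring

instance : IsNoetherianRing E.CoordRing :=
  isNoetherian_of_tower F[X] (isNoetherian_of_isNoetherianRing_of_finite F[X] E.CoordRing)

instance : IsDedekindDomain E.CoordRing := by
  have : Ring.DimensionLEOne E.CoordRing :=
    Ring.DimensionLEOne.of_isIntegral F[X] E.CoordRing
  exact {}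



/-- The valuation of the function field at `P∞`. -/
def valInf : Valuation E.FunField ℤᵐ⁰ :=
  E.valInfRing.extendToLocalization (S := E.CoordRing⁰) (fun u hu => by
    have hu0 : u ≠ 0 := nonZeroDivisors.ne_zero hu
    simp [Valuation.mem_supp_iff, valInfRing, hu0]) E.FunField

theorem valInf_algebraMap {u : E.CoordRing} (hu : u ≠ 0) :
    E.valInf (algebraMap E.CoordRing E.FunField u) =
      WithZero.exp ((Algebra.norm F[X] u).natDegree : ℤ) :=
  (Valuation.extendToLocalization_apply_map_apply ..).trans (if_neg hu)


/-- The places (closed points) of the curve: `none` is `P∞`, the others are the nonzero prime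
ideals of the Dedekind domain `F[x, y]`. -/
abbrev Place : Type u := Option (HeightOneSpectrum E.CoordRing)

/-- The point at infinity `P∞`. -/
def infty : E.Place := none

/-- The normalized discrete valuation, written multiplicatively, of a place. -/
def placeVal : E.Place → Valuation E.FunField ℤᵐ⁰
  | none => E.valInf
  | some v => v.valuation E.FunField

/-- The order of vanishing of `g ≠ 0` at a place. -/
def ord (P : E.Place) (g : E.FunField) : ℤ := -WithZero.log (E.placeVal P g)

/-- Divisors. -/
abbrev Divisor : Type u := E.Place →₀ ℤ

theorem finite_support_ord (g : E.FunField) : (Function.support fun P => E.ord P g).Finite := by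
  have h1 := HeightOneSpectrum.Support.finite E.CoordRing g
  have h2 := HeightOneSpectrum.Support.finite E.CoordRing g⁻¹
  refine (((h1.union h2).image some).union (Set.finite_singleton none)).subset ?_
  rintro (_ | v) hv
  · exact Or.inr rfl
  · refine Or.inl ⟨v, ?_, rfl⟩
    by_contra h
    simp only [HeightOneSpectrum.Support, Set.mem_union, Set.mem_ofPred_eq, not_or, not_lt,
      map_inv₀] at h
    apply hv
    by_cases hg : v.valuation E.FunField g = 0
    · simp [ord, placeVal, hg]
    have h3 : v.valuation E.FunField g = 1 :=
      le_antisymm h.1 ((inv_le_one₀ (zero_lt_iff.mpr hg)).mp h.2)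
    simp [ord, placeVal, h3]

/-- The principal divisor `(g)` of a nonzero function `g`. -/
def div (g : E.FunField) : E.Divisor :=
  Finsupp.ofSupportFinite (fun P => E.ord P g) (E.finite_support_ord g)

theorem placeVal_const_le_one (P : E.Place) (c : F) :
    E.placeVal P (algebraMap F E.FunField c) ≤ 1 := by
  rw [IsScalarTower.algebraMap_apply F E.CoordRing E.FunField]
  rcases P with _ | v
  · change E.valInf _ ≤ 1
    by_cases h : algebraMap F E.CoordRing c = 0
    · simp [h]
    · have h' : algebraMap F E.CoordRing c = C c • (1 : E.CoordRing) + (0 : F[X]) • E.y := by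
        rw [zero_smul, add_zero, ← Algebra.algebraMap_eq_smul_one,
          IsScalarTower.algebraMap_apply F F[X] E.CoordRing]
        rfl
      have hn : (Algebra.norm F[X] (algebraMap F E.CoordRing c)).natDegree = 0 := by
        rw [h', norm_repr, zero_pow two_ne_zero, zero_mul, sub_zero, ← C_pow, natDegree_C]
      rw [E.valInf_algebraMap h, hn]
      simp
  · exact HeightOneSpectrum.valuation_le_one v _

theorem nonneg_div_add_iff {g : E.FunField} (hg : g ≠ 0) (D : E.Divisor) :
    0 ≤ E.div g + D ↔ ∀ P, E.placeVal P g ≤ WithZero.exp (D P) := by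
  rw [Finsupp.le_def]
  refine forall_congr' fun P => ?_
  have h0 : E.placeVal P g ≠ 0 := (Valuation.ne_zero_iff _).mpr hg
  rw [← WithZero.log_le_iff_le_exp h0]
  change 0 ≤ -WithZero.log (E.placeVal P g) + D P ↔ _
  constructor <;> intro h <;> linarith

/-- The Riemann-Roch space `ℒ(D)`: zero and all `g` with `(g) + D ≥ 0`. -/
def RRSpace (D : E.Divisor) : Submodule F E.FunField where
  carrier := {g | g = 0 ∨ 0 ≤ E.div g + D}
  zero_mem' := Or.inl rfl
  add_mem' := by
    intro g k hg hk
    by_cases hg0 : g = 0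
    · simpa [hg0] using hk
    by_cases hk0 : k = 0
    · simpa [hk0] using hg
    by_cases h0 : g + k = 0
    · exact Or.inl h0
    refine Or.inr ((E.nonneg_div_add_iff h0 D).mpr fun P => ?_)
    exact (Valuation.map_add _ _ _).trans (max_le
      ((E.nonneg_div_add_iff hg0 D).mp (hg.resolve_left hg0) P)
      ((E.nonneg_div_add_iff hk0 D).mp (hk.resolve_left hk0) P))
  smul_mem' := by
    intro c g hg
    by_cases hg0 : g = 0
    · exact Or.inl (by simp [hg0])
    by_cases h0 : c • g = 0
    · exact Or.inl h0
    refine Or.inr ((E.nonneg_div_add_iff h0 D).mpr fun P => ?_)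
    rw [Algebra.smul_def, map_mul]
    exact (mul_le_of_le_one_left' (E.placeVal_const_le_one P c)).trans
      ((E.nonneg_div_add_iff hg0 D).mp (hg.resolve_left hg0) P)

/-- The rational affine points of the curve. -/
def AffinePoint : Type u := {P : F × F // P.2 ^ 2 = E.f.eval P.1}

/-- The number of rational points of the curve, `P∞` included. -/
def numPoints : ℕ := Nat.card (Option E.AffinePoint)

/-- The number of rational zeros of the function `y`. -/
def numZerosY : ℕ := Nat.card {P : E.AffinePoint // P.1.2 = 0}

variable {E}

/-- Evaluation of regular functions on the affine curve at a rational point. -/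
def AffinePoint.eval (P : E.AffinePoint) : E.CoordRing →ₐ[F] F :=
  AdjoinRoot.liftAlgHom E.poly (aeval P.1.1) P.1.2 (by
    change eval₂ _ _ (X ^ 2 - C E.f) = 0
    rw [eval₂_sub, eval₂_pow, eval₂_X, eval₂_C, P.2]
    simp)

theorem AffinePoint.eval_algebraMap (P : E.AffinePoint) (p : F[X]) :
    P.eval (algebraMap F[X] E.CoordRing p) = p.eval P.1.1 := by
  exact (AdjoinRoot.liftAlgHom_of ..).trans (coe_aeval_eq_eval P.1.1 ▸ rfl)

theorem AffinePoint.eval_y (P : E.AffinePoint) : P.eval E.y = P.1.2 :=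
  AdjoinRoot.liftAlgHom_root ..

/-- The place of a rational affine point: the ideal of functions vanishing at the point. -/
def AffinePoint.place (P : E.AffinePoint) : HeightOneSpectrum E.CoordRing where
  asIdeal := RingHom.ker P.eval
  isPrime := RingHom.ker_isPrime _
  ne_bot := by
    intro h
    have h1 : algebraMap F[X] E.CoordRing (X - C P.1.1) ∈ RingHom.ker P.eval := by
      rw [RingHom.mem_ker, P.eval_algebraMap]; simp
    rw [h, Ideal.mem_bot, FaithfulSMul.algebraMap_eq_zero_iff] at h1
    exact X_sub_C_ne_zero _ h1

variable {N : ℕ}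

/-- The elements of `F[x, y]` that vanish at none of the points `R i`. -/
def nonvanishing (R : Fin N → E.AffinePoint) : Submonoid E.CoordRing where
  carrier := {v | v ≠ 0 ∧ ∀ i, (R i).eval v ≠ 0}
  one_mem' := by simp
  mul_mem' := fun hu hv =>
    ⟨mul_ne_zero hu.1 hv.1, fun i => by rw [map_mul]; exact mul_ne_zero (hu.2 i) (hv.2 i)⟩

open scoped nonZeroDivisors in
theorem nonvanishing_le (R : Fin N → E.AffinePoint) : nonvanishing R ≤ E.CoordRing⁰ :=
  fun _ hv => mem_nonZeroDivisors_of_ne_zero hv.1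

/-- The algebra `A` of rational functions that are regular at all the points `R i`: the fractions
`u / v` with `u, v` in `F[x, y]` and `v` vanishing at none of the `R i`. -/
def regularAlg (R : Fin N → E.AffinePoint) : Subalgebra F E.FunField :=
  (Localization.subalgebra.ofField E.FunField (nonvanishing R) (nonvanishing_le R)).restrictScalars F

instance (R : Fin N → E.AffinePoint) : Algebra E.CoordRing (regularAlg R) :=
  inferInstanceAs (Algebra E.CoordRing
    (Localization.subalgebra.ofField E.FunField (nonvanishing R) (nonvanishing_le R)))

instance (R : Fin N → E.AffinePoint) : IsLocalization (nonvanishing R) (regularAlg R) :=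
  inferInstanceAs (IsLocalization (nonvanishing R)
    (Localization.subalgebra.ofField E.FunField (nonvanishing R) (nonvanishing_le R)))

instance (R : Fin N → E.AffinePoint) : IsScalarTower F E.CoordRing (regularAlg R) :=
  inferInstanceAs (IsScalarTower F E.CoordRing
    (Localization.subalgebra.ofField E.FunField (nonvanishing R) (nonvanishing_le R)))

/-- The evaluation homomorphism `φ : A → F ^ N`, `g ↦ (g (R 1), …, g (R N))`; a fraction `u / v` is
sent to `u (R i) / v (R i)`. -/
def evalMap (R : Fin N → E.AffinePoint) : regularAlg R →ₐ[F] (Fin N → F) :=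
  IsLocalization.liftAlgHom (M := nonvanishing R) (f := AlgHom.pi fun i => (R i).eval)
    (fun v => Pi.isUnit_iff.mpr fun i => isUnit_iff_ne_zero.mpr (v.2.2 i))

variable (E) in
/-- Affine rational points `P j = (α j, β j)` and `P̄ j = (α j, - β j)`, `j = 1, …, J`. Since
`β j ≠ 0`, these `2 J` points are distinct exactly when the `α j` are. -/
structure InterpPoints (J : ℕ) where
  α : Fin J → F
  β : Fin J → F
  on_curve : ∀ j, β j ^ 2 = E.f.eval (α j)
  β_ne_zero : ∀ j, β j ≠ 0
  α_injective : Function.Injective α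

namespace InterpPoints

variable {J : ℕ} (I : E.InterpPoints J)

/-- The point `P j = (α j, β j)`. -/
def P (j : Fin J) : E.AffinePoint := ⟨(I.α j, I.β j), I.on_curve j⟩

/-- The point `P̄ j = (α j, - β j)`. -/
def Pbar (j : Fin J) : E.AffinePoint := ⟨(I.α j, -I.β j), (neg_sq (I.β j)).trans (I.on_curve j)⟩

/-- The function `x - α j`. -/
def lin (j : Fin J) : E.FunField :=
  algebraMap E.CoordRing E.FunField (E.x - algebraMap F E.CoordRing (I.α j))

/-- `h = 1 / ((x - α 1) ⋯ (x - α J))`. -/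
def h : E.FunField := (∏ j, I.lin j)⁻¹

/-- `h_j⁽¹⁾ = h ∏_{j' ∈ [J] ∖ j} (x - α j')`. -/
def h1 (j : Fin J) : E.FunField := I.h * ∏ j' ∈ Finset.univ.erase j, I.lin j'

/-- `h_j⁽²⁾ = h y ∏_{j' ∈ [J - 1] ∖ j} (x - α j')`. -/
def h2 (j : Fin (J - 1)) : E.FunField :=
  I.h * algebraMap E.CoordRing E.FunField E.y *
    ∏ j' ∈ Finset.univ.erase j, I.lin (Fin.castLE (Nat.sub_le J 1) j')

/-- The functions `h_ℓ`, that is, `h_1⁽¹⁾, …, h_J⁽¹⁾, h_1⁽²⁾, …, h_{J-1}⁽²⁾`. The `2 J - 1 = L`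
fragments are indexed by the disjoint union of `[J]` and `[J - 1]`. -/
def interp : Fin J ⊕ Fin (J - 1) → E.FunField := Sum.elim I.h1 I.h2

/-- `D^info = ∑_j (P j + P̄ j) - P∞`. -/
def divInfo : E.Divisor :=
  ∑ j, (Finsupp.single (some (I.P j).place) 1 + Finsupp.single (some (I.Pbar j).place) 1) -
    Finsupp.single E.infty 1

/-- `D_ℓ^sec = (X + 1) P∞ + (h_ℓ)`. -/
def divSec (X : ℕ) (ℓ : Fin J ⊕ Fin (J - 1)) : E.Divisor :=
  Finsupp.single E.infty ((X : ℤ) + 1) + E.div (I.interp ℓ)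

/-- `D_ℓ^query = - (h_ℓ)`. -/
def divQuery (ℓ : Fin J ⊕ Fin (J - 1)) : E.Divisor := -E.div (I.interp ℓ)

end InterpPoints

variable (E) in
/-- `D_ℓ^priv = (T + 1) P∞`. -/
def divPriv (T : ℕ) : E.Divisor := Finsupp.single E.infty ((T : ℤ) + 1)

/-- The subspace `ℒ(D) ∩ A` of the algebra `A` of functions regular at the points `R i`; it is all of
`ℒ(D)` when `ℒ(D) ⊆ A`. -/
def RRSpaceIn (R : Fin N → E.AffinePoint) (D : E.Divisor) : Submodule F (regularAlg R) :=
  (E.RRSpace D).comap (regularAlg R).val.toLinearMap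

end EllipticCurve

/-- A private information retrieval scheme with `M` files from the alphabet `File` and `N` servers.
The files are stored with the help of a random element of `StoreRand`, server `n` holding
`store W ω n`; the user who wants file `θ` draws, independently of the stored data, a random element
of `QueryRand` and sends `query θ η n` to server `n`, which returns
`answer n (store W ω n) (query θ η n)`. Both random elements are uniformly distributed. -/
structure PIRScheme (File : Type u) (M N : ℕ) where
  StoreRand : Type u
  QueryRand : Type u
  Share : Type u
  Query : Type u
  Answer : Type u
  store : (Fin M → File) → StoreRand → Fin N → Share
  query : Fin M → QueryRand → Fin N → Query
  answer : Fin N → Share → Query → Answer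

namespace PIRScheme

/-- The probability of an event for the uniform distribution on a finite nonempty type. -/
def prob {Ω : Type u} (p : Ω → Prop) : ℚ := Nat.card {ω // p ω} / Nat.card Ω

variable {File : Type u} {M N : ℕ} (S : PIRScheme File M N)

/-- What server `n` sees: its share, its query and its answer. -/
def view (W : Fin M → File) (θ : Fin M) (ω : S.StoreRand) (η : S.QueryRand) (n : Fin N) :
    S.Share × S.Query × S.Answer :=
  (S.store W ω n, S.query θ η n, S.answer n (S.store W ω n) (S.query θ η n))

/-- The desired file can always be recovered from the desired index, the queries and the answers. -/
def IsCorrect : Prop :=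
  ∃ decode : Fin M → (Fin N → S.Query) → (Fin N → S.Answer) → File,
    ∀ (W : Fin M → File) (θ : Fin M) (ω : S.StoreRand) (η : S.QueryRand),
      decode θ (S.query θ η) (fun n => S.answer n (S.store W ω n) (S.query θ η n)) = W θ

/-- `X`-security: the joint distribution of the shares of at most `X` servers does not depend on the
files. -/
def IsSecure (X : ℕ) : Prop :=
  ∀ I : Finset (Fin N), I.card ≤ X → ∀ (W W' : Fin M → File) (s : I → S.Share),
    prob (fun ω : S.StoreRand => (fun n : I => S.store W ω n) = s) =
      prob (fun ω : S.StoreRand => (fun n : I => S.store W' ω n) = s)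

/-- `T`-privacy: for all contents of the files, the joint distribution of everything that at most `T`
servers see does not depend on the index of the desired file. -/
def IsPrivate (T : ℕ) : Prop :=
  ∀ I : Finset (Fin N), I.card ≤ T → ∀ (W : Fin M → File) (θ θ' : Fin M)
    (v : I → S.Share × S.Query × S.Answer),
    prob (fun r : S.StoreRand × S.QueryRand => (fun n : I => S.view W θ r.1 r.2 n) = v) =
      prob (fun r : S.StoreRand × S.QueryRand => (fun n : I => S.view W θ' r.1 r.2 n) = v)

/-- The rate: the size of one file divided by the total size of the `N` downloaded answers. -/
def rate : ℝ := Real.log (Nat.card File) / (N * Real.log (Nat.card S.Answer))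

/-- An `X`-secure and `T`-private information retrieval scheme. -/
structure IsSecurePrivate (X T : ℕ) : Prop where
  finite_storeRand : Finite S.StoreRand
  nonempty_storeRand : Nonempty S.StoreRand
  finite_queryRand : Finite S.QueryRand
  nonempty_queryRand : Nonempty S.QueryRand
  finite_answer : Finite S.Answer
  correct : S.IsCorrect
  secure : S.IsSecure X
  priv : S.IsPrivate T

/-- The scheme over an algebra `A` with evaluation map `φ : A → F ^ N`. A file consists of symbols of
`F`, its fragments, indexed by `ι`. Fragment `ℓ` of file `m` is encoded as `f^enc = enc (W m ℓ)` and
stored as `s = f^enc + f^sec` with `f^sec` uniform in `Vsec ℓ`; the query is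
`q = g^query + g^priv` with `g^query = h ℓ` if `m = θ` and `0` otherwise, and `g^priv` uniform in
`Vpriv ℓ`. Server `n` gets the `n`-th coordinates of all `φ s` and `φ q` and returns
`∑ (φ s)_n (φ q)_n`. -/
def ofAlgebra {F : Type u} [Field F] {A : Type u} [CommRing A] [Algebra F A] {ι : Type} [Fintype ι]
    (M : ℕ) {N : ℕ} (enc : F →ₗ[F] A) (Vsec : ι → Submodule F A) (h : ι → A)
    (Vpriv : ι → Submodule F A) (φ : A →ₐ[F] (Fin N → F)) : PIRScheme (ι → F) M N where
  StoreRand := (ℓ : ι) → Fin M → Vsec ℓ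
  QueryRand := (ℓ : ι) → Fin M → Vpriv ℓ
  Share := ι → Fin M → F
  Query := ι → Fin M → F
  Answer := F
  store W ω n ℓ m := φ (enc (W m ℓ) + ω ℓ m) n
  query θ η n ℓ m := φ ((if m = θ then h ℓ else 0) + η ℓ m) n
  answer _ s q := ∑ ℓ, ∑ m, s ℓ m * q ℓ m

end PIRScheme

end

/-! Everything reduces to functions whose only pole is `P∞`. The norm of `p + q y` shows that ℒ(n
P∞) consists of the `p + q y` with 2 deg p ≤ n and 2 deg q + 3 ≤ n, so it has dimension n for n ≥ 1.
Since g ↦ g h maps ℒ(D + (h)) onto ℒ(D), the other spaces are translates of these. In particular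
D^info = (2J - 1) P∞ + (∏ (x - α_j)), and the numerators of the h_ℓ are Lagrange polynomials in x
and y times such polynomials. This gives the dimensions and the basis.

Security and privacy are a one-time pad. Functions in ℒ((s + 1) P∞) take arbitrary values at s
rational points (`exists_mem_poleSpace_eval_eq`), so a translation of the randomness absorbs any
change of files or of θ seen by a small set of servers.

For correctness, the answers are the values of ∑ w_ℓ h_ℓ + v with v noise. The function y v is
regular on the affine curve with pole order at most X + T + 7 at `P∞`; the worst noise is a product
f g, where y / h_ℓ contributes at most 5. If such a function with coefficients c_ℓ vanishes at all
R_n, multiplying it by y ∏ (x - α_j) gives an element u of ℒ(N P∞), N = 2J + X + T + 7, vanishing at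
N points. Such a u could be nonzero only if the R_n summed to zero on the curve. The R_n are
conjugate pairs together with one or two unpaired points, and then u = 0 by counting roots of p and
q. At P_j and P̄_j the noise part of u carries the factor ∏ (x - α_j) and drops out, so the Lagrange
property gives c = 0. -/

noncomputable section

/-! ### Functions with poles only at infinity. -/

namespace EllipticCurve

open Polynomial IsDedekindDomain Module

variable {F : Type u} [Field F] (E : EllipticCurve F)

/-- The linear map `(p, q) ↦ p + q y`. -/
def ofPair : F[X] × F[X] →ₗ[F] E.CoordRing where
  toFun w := w.1 • 1 + w.2 • E.y
  map_add' a b := by simp only [Prod.fst_add, Prod.snd_add, add_smul]; abel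
  map_smul' c a := by simp [smul_assoc]

theorem ofPair_apply (p q : F[X]) : E.ofPair (p, q) = p • 1 + q • E.y := rfl

/-- The leading terms of the norm cannot cancel, so a zero norm forces both degrees to be ⊥. -/
theorem ofPair_injective : Function.Injective E.ofPair := by
  rw [injective_iff_map_eq_zero]
  rintro ⟨p, q⟩ h
  have h1 := E.degree_norm_repr p q
  rw [← ofPair_apply, h, Algebra.norm_zero, degree_zero, eq_comm, max_eq_bot] at h1
  have hp : p = 0 := by
    by_contra hp
    rw [degree_eq_natDegree hp] at h1
    exact absurd h1.1 (by rw [← Nat.cast_smul_eq_nsmul (WithBot ℕ)]; exact WithBot.coe_ne_bot)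
  have hq : q = 0 := by
    by_contra hq
    rw [degree_eq_natDegree hq] at h1
    exact absurd h1.2 (by rw [← Nat.cast_smul_eq_nsmul (WithBot ℕ)]; exact WithBot.coe_ne_bot)
  rw [hp, hq]; rfl

theorem exists_ofPair (u : E.CoordRing) : ∃ p q : F[X], u = E.ofPair (p, q) := E.exists_repr u

/-- The pole orders 2 deg p and 2 deg q + 3 are bounded separately. For n ≤ 2 the truncated (n - 1)
/ 2 is 0, which rightly forces q = 0. -/
theorem natDegree_norm_ofPair_le_iff (p q : F[X]) (n : ℕ) :
    (Algebra.norm F[X] (E.ofPair (p, q))).natDegree ≤ n ↔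
      p ∈ degreeLT F (n / 2 + 1) ∧ q ∈ degreeLT F ((n - 1) / 2) := by
  rw [natDegree_le_iff_degree_le, ofPair_apply, degree_norm_repr, max_le_iff, mem_degreeLT,
    mem_degreeLT]
  refine and_congr ?_ ?_
  · by_cases hp : p = 0
    · simp [hp]
    rw [degree_eq_natDegree hp, two_nsmul]
    norm_cast
    omega
  · by_cases hq : q = 0
    · simp [hq]
    rw [degree_eq_natDegree hq, two_nsmul]
    norm_cast
    omega

/-- The functions on the affine curve whose pole at `P∞` has order at most `n`. -/
def poleSpace (n : ℕ) : Submodule F E.CoordRing where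
  carrier := {u | (Algebra.norm F[X] u).natDegree ≤ n}
  zero_mem' := by simp
  add_mem' := by
    intro u v hu hv
    simp only [Set.mem_ofPred_eq, natDegree_le_iff_degree_le] at *
    exact (E.degree_norm_add_le u v).trans (max_le hu hv)
  smul_mem' := by
    intro c u hu
    obtain ⟨p, q, rfl⟩ := E.exists_ofPair u
    simp only [Set.mem_ofPred_eq] at *
    rw [← map_smul, Prod.smul_mk, natDegree_norm_ofPair_le_iff]
    rw [natDegree_norm_ofPair_le_iff] at hu
    exact ⟨Submodule.smul_mem _ _ hu.1, Submodule.smul_mem _ _ hu.2⟩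

variable {E}

theorem mem_poleSpace {n : ℕ} {u : E.CoordRing} :
    u ∈ E.poleSpace n ↔ (Algebra.norm F[X] u).natDegree ≤ n := Iff.rfl

theorem ofPair_mem_poleSpace {n : ℕ} {p q : F[X]} : E.ofPair (p, q) ∈ E.poleSpace n ↔
    p ∈ degreeLT F (n / 2 + 1) ∧ q ∈ degreeLT F ((n - 1) / 2) :=
  E.natDegree_norm_ofPair_le_iff p q n

theorem poleSpace_mono {m n : ℕ} (h : m ≤ n) : E.poleSpace m ≤ E.poleSpace n :=
  fun _ hu => le_trans (mem_poleSpace.mp hu) h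

theorem mul_mem_poleSpace {m n : ℕ} {u v : E.CoordRing} (hu : u ∈ E.poleSpace m)
    (hv : v ∈ E.poleSpace n) : u * v ∈ E.poleSpace (m + n) := by
  rw [mem_poleSpace, map_mul]
  exact natDegree_mul_le.trans (add_le_add hu hv)

variable (E) in
/-- The parametrization of `poleSpace n` by pairs of polynomials. -/
def poleSpaceEquiv (n : ℕ) :
    (degreeLT F (n / 2 + 1) × degreeLT F ((n - 1) / 2)) ≃ₗ[F] E.poleSpace n :=
  LinearEquiv.ofBijective
    ((E.ofPair ∘ₗ ((degreeLT F (n / 2 + 1)).subtype.prodMap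
      (degreeLT F ((n - 1) / 2)).subtype)).codRestrict (E.poleSpace n)
        fun w => ofPair_mem_poleSpace.mpr ⟨w.1.2, w.2.2⟩) (by
    refine ⟨fun a b h => ?_, fun ⟨u, hu⟩ => ?_⟩
    · have h1 := E.ofPair_injective (congrArg Subtype.val h)
      exact Prod.ext (Subtype.ext (congrArg Prod.fst h1)) (Subtype.ext (congrArg Prod.snd h1))
    · obtain ⟨p, q, rfl⟩ := E.exists_ofPair u
      obtain ⟨hp, hq⟩ := ofPair_mem_poleSpace.mp hu
      exact ⟨(⟨p, hp⟩, ⟨q, hq⟩), rfl⟩)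

instance (n : ℕ) : FiniteDimensional F (degreeLT F n) :=
  .equiv (degreeLTEquiv F n).symm

instance (n : ℕ) : FiniteDimensional F (E.poleSpace n) :=
  .equiv (E.poleSpaceEquiv n)

/-- Riemann–Roch in genus one: (n / 2 + 1) + (n - 1) / 2 = n. For n = 0 this fails, because the
constants remain. -/
theorem finrank_poleSpace {n : ℕ} (hn : 0 < n) : finrank F (E.poleSpace n) = n := by
  rw [← (E.poleSpaceEquiv n).finrank_eq, finrank_prod, (degreeLTEquiv F _).finrank_eq,
    (degreeLTEquiv F _).finrank_eq, finrank_fin_fun, finrank_fin_fun]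
  omega

theorem algebraMap_eq_ofPair (p : F[X]) : algebraMap F[X] E.CoordRing p = E.ofPair (p, 0) := by
  rw [ofPair_apply, zero_smul, add_zero, Algebra.algebraMap_eq_smul_one]

theorem y_eq_ofPair : E.y = E.ofPair (0, 1) := by
  simp [ofPair_apply]

theorem algebraMap_mem_poleSpace {p : F[X]} {n : ℕ} (hp : 2 * p.natDegree ≤ n) :
    algebraMap F[X] E.CoordRing p ∈ E.poleSpace n := by
  rw [algebraMap_eq_ofPair, ofPair_mem_poleSpace, mem_degreeLT]
  refine ⟨degree_le_natDegree.trans_lt ?_, Submodule.zero_mem _⟩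
  norm_cast; omega

theorem y_mem_poleSpace : E.y ∈ E.poleSpace 3 := by
  rw [y_eq_ofPair, ofPair_mem_poleSpace, mem_degreeLT, mem_degreeLT]
  refine ⟨by rw [degree_zero]; exact WithBot.bot_lt_coe _, ?_⟩
  rw [degree_one]; norm_num

/-- Neither 2 deg p nor 2 deg q + 3 equals 1: a curve of genus one carries no function with a single
simple pole. -/
theorem exists_const_of_mem_poleSpace_one {u : E.CoordRing} (hu : u ∈ E.poleSpace 1) :
    ∃ c : F, u = algebraMap F E.CoordRing c := by
  obtain ⟨p, q, rfl⟩ := E.exists_ofPair u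
  obtain ⟨hp, hq⟩ := ofPair_mem_poleSpace.mp hu
  rw [mem_degreeLT] at hp hq
  have hq0 : q = 0 := by simpa using hq
  have hp0 : p.degree ≤ 0 := by
    by_cases h : p = 0
    · simp [h]
    rw [degree_eq_natDegree h] at hp ⊢
    norm_cast at hp ⊢
    omega
  rw [eq_C_of_degree_le_zero hp0, hq0, ← algebraMap_eq_ofPair]
  exact ⟨p.coeff 0, (IsScalarTower.algebraMap_apply F F[X] E.CoordRing _).symm⟩

theorem algebraMap_mem_poleSpace_zero (c : F) : algebraMap F E.CoordRing c ∈ E.poleSpace 0 := by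
  rw [IsScalarTower.algebraMap_apply F F[X] E.CoordRing]
  exact algebraMap_mem_poleSpace (by simp)

/-! ### Evaluation and interpolation at rational points. -/

theorem AffinePoint.eval_ofPair (P : E.AffinePoint) (p q : F[X]) :
    P.eval (E.ofPair (p, q)) = p.eval P.1.1 + q.eval P.1.1 * P.1.2 := by
  rw [ofPair_apply, Algebra.smul_def, Algebra.smul_def, map_add, map_mul, map_mul, map_one,
    P.eval_algebraMap, P.eval_algebraMap, P.eval_y, mul_one]

/-- Simultaneous evaluation at a family of rational points. -/
def evalAt {ι : Type*} (Q : ι → E.AffinePoint) : E.CoordRing →ₐ[F] (ι → F) :=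
  AlgHom.pi fun i => (Q i).eval

theorem evalAt_apply {ι : Type*} (Q : ι → E.AffinePoint) (u : E.CoordRing) (i : ι) :
    evalAt Q u i = (Q i).eval u := rfl

theorem exists_eval_separating {P Q : E.AffinePoint} (h : P ≠ Q) :
    ∃ u : E.CoordRing, P.eval u ≠ 0 ∧ Q.eval u = 0 := by
  by_cases hx : P.1.1 = Q.1.1
  · have hy : P.1.2 ≠ Q.1.2 := fun hy => h (Subtype.ext (Prod.ext hx hy))
    refine ⟨E.y - algebraMap F[X] E.CoordRing (C Q.1.2), ?_, ?_⟩
    · rwa [map_sub, AffinePoint.eval_y, AffinePoint.eval_algebraMap, eval_C, sub_ne_zero]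
    · rw [map_sub, AffinePoint.eval_y, AffinePoint.eval_algebraMap, eval_C, sub_self]
  · refine ⟨algebraMap F[X] E.CoordRing (X - C Q.1.1), ?_, ?_⟩
    · rwa [AffinePoint.eval_algebraMap, eval_sub, eval_X, eval_C, sub_ne_zero]
    · rw [AffinePoint.eval_algebraMap, eval_sub, eval_X, eval_C, sub_self]

/-- A product of separating functions vanishes at all the points but one; rescaled, these products
interpolate. -/
theorem evalAt_surjective {ι : Type*} [Fintype ι] {Q : ι → E.AffinePoint}
    (hQ : Function.Injective Q) : Function.Surjective (evalAt Q) := by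
  classical
  have hsep (i j : ι) : ∃ u : E.CoordRing, i ≠ j → (Q i).eval u ≠ 0 ∧ (Q j).eval u = 0 := by
    by_cases hij : i = j
    · exact ⟨0, fun h => absurd hij h⟩
    · obtain ⟨u, hu⟩ := exists_eval_separating (hQ.ne hij)
      exact ⟨u, fun _ => hu⟩
  choose u hu using hsep
  intro t
  let d (i : ι) : E.CoordRing := ∏ j ∈ Finset.univ.erase i, u i j
  have hd (i : ι) : (Q i).eval (d i) ≠ 0 := by
    rw [map_prod, Finset.prod_ne_zero_iff]
    exact fun j hj => (hu i j (Finset.ne_of_mem_erase hj).symm).1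
  have hd0 (i j : ι) (h : i ≠ j) : (Q j).eval (d i) = 0 := by
    rw [map_prod]
    exact Finset.prod_eq_zero (Finset.mem_erase.mpr ⟨h.symm, Finset.mem_univ j⟩) (hu i j h).2
  refine ⟨∑ i, (t i / (Q i).eval (d i)) • d i, funext fun j => ?_⟩
  rw [evalAt_apply, map_sum, Finset.sum_eq_single j]
  · rw [map_smul, smul_eq_mul, div_mul_cancel₀ _ (hd j)]
  · intro i _ h
    rw [map_smul, hd0 i j h, smul_zero]
  · simp

/-- A function whose pole order does not exceed the number of its zeros divides every other function
with these zeros. -/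
theorem dvd_of_evalAt_eq_zero {ι : Type*} [Fintype ι] [Nonempty ι] {Q : ι → E.AffinePoint}
    (hQ : Function.Injective Q) {u : E.CoordRing} (hu0 : u ≠ 0)
    (hu : u ∈ E.poleSpace (Fintype.card ι)) (hQu : evalAt Q u = 0) :
    (Algebra.norm F[X] u).natDegree = Fintype.card ι ∧
      ∀ v, evalAt Q v = 0 → u ∣ v := by
  -- F[x, y] / (u) has dimension equal to the pole order of u, and evaluation maps it onto F^ι. The
  -- bound on the pole order makes this map bijective, so the functions vanishing at all Q i form
  -- the ideal (u).
  have hfr := finrank_quotient_span_eq_natDegree_norm (F := F) E.basis hu0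
  -- Positivity excludes the default value 0 of `finrank` in infinite dimension: pole order 0 would
  -- make u a constant with a zero.
  have hpos : 0 < finrank F (E.CoordRing ⧸ Ideal.span {u}) := by
    rw [hfr, Nat.pos_iff_ne_zero]
    intro h
    have h1 : u ∈ E.poleSpace 1 := by rw [mem_poleSpace, h]; exact zero_le_one
    obtain ⟨c, rfl⟩ := exists_const_of_mem_poleSpace_one h1
    rw [AlgHom.commutes] at hQu
    obtain ⟨i⟩ := ‹Nonempty ι›
    have hc : c = 0 := congrFun hQu i
    exact hu0 (by rw [hc, map_zero])
  have : FiniteDimensional F (E.CoordRing ⧸ Ideal.span {u}) := .of_finrank_pos hpos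
  let φ : (E.CoordRing ⧸ Ideal.span {u}) →ₐ[F] (ι → F) :=
    Ideal.Quotient.liftₐ _ (evalAt Q) fun a ha => by
      obtain ⟨b, rfl⟩ := Ideal.mem_span_singleton'.mp ha
      rw [map_mul, hQu, mul_zero]
  have hφ (a : E.CoordRing) : φ (Ideal.Quotient.mk _ a) = evalAt Q a := rfl
  have hsurj : Function.Surjective φ.toLinearMap := fun t => by
    obtain ⟨a, ha⟩ := evalAt_surjective hQ t
    exact ⟨Ideal.Quotient.mk _ a, ha⟩
  have hge := LinearMap.finrank_le_finrank_of_surjective hsurj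
  rw [finrank_fintype_fun_eq_card, hfr] at hge
  have heq := le_antisymm (mem_poleSpace.mp hu) hge
  refine ⟨heq, fun v hv => ?_⟩
  have hinj := (LinearMap.injective_iff_surjective_of_finrank_eq_finrank
    (by rw [finrank_fintype_fun_eq_card, hfr, heq])).mpr hsurj
  rw [← Ideal.mem_span_singleton, ← Ideal.Quotient.eq_zero_iff_mem]
  exact hinj ((hφ v).trans (hv.trans (map_zero φ).symm))

/-- Functions with a pole of order at most `s + 1` at infinity interpolate arbitrary values at `s`
rational points. -/
theorem exists_mem_poleSpace_eval_eq {ι : Type*} [Fintype ι] {Q : ι → E.AffinePoint}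
    (hQ : Function.Injective Q) {n : ℕ} (hn : Fintype.card ι < n) (t : ι → F) :
    ∃ u ∈ E.poleSpace n, ∀ i, (Q i).eval u = t i := by
  rcases isEmpty_or_nonempty ι with hι | hι
  · exact ⟨0, Submodule.zero_mem _, fun i => hι.elim i⟩
  set s := Fintype.card ι with hs
  have hs0 : 0 < s := Fintype.card_pos
  let e : E.poleSpace (s + 1) →ₗ[F] (ι → F) := (evalAt Q).toLinearMap ∘ₗ (E.poleSpace (s + 1)).subtype
  suffices h : Function.Surjective e by
    obtain ⟨u, hu⟩ := h t
    exact ⟨u, poleSpace_mono hn u.2, fun i => congrFun hu i⟩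
  -- If evaluation is not onto, its kernel K in ℒ((s + 1) P∞) has dimension at least 2, so K meets
  -- the hyperplane ℒ(s P∞) in some u ≠ 0. Such a u divides every element of K with quotient of pole
  -- order at most 1, hence constant, so dim K ≤ 1, a contradiction.
  rw [← LinearMap.range_eq_top]
  by_contra hne
  have h1 : finrank F e.range < s := by
    have := Submodule.finrank_lt hne
    rwa [finrank_fintype_fun_eq_card] at this
  have h2 := e.finrank_range_add_finrank_ker
  rw [finrank_poleSpace s.succ_pos] at h2
  let K := e.ker.map (E.poleSpace (s + 1)).subtype
  have hK : finrank F K = finrank F e.ker :=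
    (Submodule.equivMapOfInjective _ (Submodule.injective_subtype _) e.ker).finrank_eq.symm
  have hKle : K ≤ E.poleSpace (s + 1) := Submodule.map_subtype_le _ _
  have hKe (u) (hu : u ∈ K) : evalAt Q u = 0 := by
    obtain ⟨w, hw, rfl⟩ := hu
    exact hw
  have h3 := Submodule.finrank_sup_add_finrank_inf_eq K (E.poleSpace s)
  rw [finrank_poleSpace hs0] at h3
  have h4 : finrank F ↥(K ⊔ E.poleSpace s) ≤ s + 1 := by
    refine (Submodule.finrank_mono (sup_le hKle (poleSpace_mono s.le_succ))).trans ?_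
    exact (finrank_poleSpace s.succ_pos).le
  have h5 : 0 < finrank F ↥(K ⊓ E.poleSpace s) := by omega
  obtain ⟨u, hu0⟩ := (finrank_pos_iff_exists_ne_zero (R := F)).mp h5
  obtain ⟨hdeg, hdvd⟩ := dvd_of_evalAt_eq_zero hQ (fun h => hu0 (Subtype.ext h)) u.2.2 (hKe _ u.2.1)
  have h6 : finrank F K ≤ 1 := by
    refine finrank_le_one ⟨u.1, u.2.1⟩ fun v => ?_
    obtain ⟨w, hw⟩ := hdvd _ (hKe _ v.2)
    by_cases hw0 : w = 0
    · exact ⟨0, Subtype.ext (by simp [hw, hw0])⟩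
    have h7 : w ∈ E.poleSpace 1 := by
      have := mem_poleSpace.mp (hKle v.2)
      rw [hw, map_mul, natDegree_mul (E.norm_ne_zero fun h => hu0 (Subtype.ext h))
        (E.norm_ne_zero hw0), hdeg] at this
      rw [mem_poleSpace]; omega
    obtain ⟨c, rfl⟩ := exists_const_of_mem_poleSpace_one h7
    refine ⟨c, Subtype.ext ?_⟩
    rw [hw, mul_comm, ← Algebra.smul_def]; rfl
  omega

/-- If a set of rational points has `k + k'` points, namely points with `k` distinct abscissas and the
conjugates of `k'` of them, then suitable bounds on the pole order and the vanishing at these points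
force a function to be zero. -/
theorem eq_zero_of_eval_eq_zero {n k k' : ℕ} (hk : n / 2 < k) (hk' : (n - 1) / 2 ≤ k')
    {u : E.CoordRing} (hu : u ∈ E.poleSpace n) {a b : Fin k → F} (ha : Function.Injective a)
    {ι : Fin k' → Fin k} (hι : Function.Injective ι) (hb : ∀ i, b (ι i) ≠ 0)
    {P : Fin k → E.AffinePoint} (hP : ∀ i, (P i).1 = (a i, b i)) {P' : Fin k' → E.AffinePoint}
    (hP' : ∀ i, (P' i).1 = (a (ι i), -b (ι i))) (h : ∀ i, (P i).eval u = 0)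
    (h' : ∀ i, (P' i).eval u = 0) : u = 0 := by
  obtain ⟨p, q, rfl⟩ := E.exists_ofPair u
  obtain ⟨hp, hq⟩ := ofPair_mem_poleSpace.mp hu
  rw [mem_degreeLT] at hp hq
  simp only [AffinePoint.eval_ofPair, hP, hP'] at h h'
  -- Subtracting the values at (a, b) and (a, -b) leaves 2 b q(a), so q has more roots than its
  -- degree allows; then p vanishes at all k abscissas.
  have hq0 : q = 0 := by
    refine eq_zero_of_degree_lt_of_eval_index_eq_zero (v := a ∘ ι) Finset.univ
      (ha.comp hι).injOn (hq.trans_le ?_) fun i _ => ?_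
    · simpa using hk'
    · have h1 : 2 * b (ι i) * eval (a (ι i)) q = 0 := by linear_combination h (ι i) - h' i
      exact (mul_eq_zero.mp h1).resolve_left (mul_ne_zero E.two_ne_zero_field (hb i))
  have hp0 : p = 0 := by
    refine eq_zero_of_degree_lt_of_eval_index_eq_zero (v := a) Finset.univ
      ha.injOn (hp.trans_le ?_) fun i _ => ?_
    · simp only [Finset.card_univ, Fintype.card_fin]; exact_mod_cast hk
    · simpa [hq0] using h i
  rw [hp0, hq0]
  exact map_zero E.ofPair

end EllipticCurve

/-! ### Riemann–Roch spaces and principal divisors. -/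

namespace EllipticCurve

open Polynomial IsDedekindDomain Module

variable {F : Type u} [Field F] {E : EllipticCurve F}

theorem mem_RRSpace {D : E.Divisor} {g : E.FunField} :
    g ∈ E.RRSpace D ↔ ∀ P, E.placeVal P g ≤ WithZero.exp (D P) := by
  by_cases hg : g = 0
  · simp [hg]
  · rw [← E.nonneg_div_add_iff hg]
    exact ⟨fun h => h.resolve_left hg, Or.inr⟩

theorem placeVal_eq_exp {h : E.FunField} (hh : h ≠ 0) (P : E.Place) :
    E.placeVal P h = WithZero.exp (-E.div h P) := by
  have h0 : E.placeVal P h ≠ 0 := (Valuation.ne_zero_iff _).mpr hh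
  change _ = WithZero.exp (- -WithZero.log (E.placeVal P h))
  rw [neg_neg, WithZero.exp_log h0]

/-- This rests on (g h) = (g) + (h), and it moves every space used here to one with poles only at
`P∞`. -/
theorem mem_RRSpace_add_div {D : E.Divisor} {g h : E.FunField} (hh : h ≠ 0) :
    g ∈ E.RRSpace (D + E.div h) ↔ g * h ∈ E.RRSpace D := by
  rw [mem_RRSpace, mem_RRSpace]
  refine forall_congr' fun P => ?_
  rw [map_mul, placeVal_eq_exp hh, Finsupp.add_apply, WithZero.exp_add, WithZero.exp_neg,
    mul_inv_le_iff₀ (WithZero.exp_pos)]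

theorem finrank_RRSpace_add_div (D : E.Divisor) {h : E.FunField} (hh : h ≠ 0) :
    finrank F (E.RRSpace (D + E.div h)) = finrank F (E.RRSpace D) := by
  have hinj : Function.Injective (LinearMap.mulRight F h) := mul_left_injective₀ hh
  have e : (E.RRSpace (D + E.div h)).map (LinearMap.mulRight F h) = E.RRSpace D := by
    ext g
    refine ⟨?_, fun hg => ⟨g * h⁻¹, ?_, ?_⟩⟩
    · rintro ⟨k, hk, rfl⟩
      exact (mem_RRSpace_add_div hh).mp hk
    · exact (mem_RRSpace_add_div hh).mpr (by rwa [inv_mul_cancel_right₀ hh])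
    · exact inv_mul_cancel_right₀ hh g
  rw [← e]
  exact (Submodule.equivMapOfInjective _ hinj _).finrank_eq

theorem div_mul {g h : E.FunField} (hg : g ≠ 0) (hh : h ≠ 0) :
    E.div (g * h) = E.div g + E.div h := by
  ext P
  have := placeVal_eq_exp (mul_ne_zero hg hh) P
  rw [map_mul, placeVal_eq_exp hg, placeVal_eq_exp hh, ← WithZero.exp_add,
    WithZero.exp_inj] at this
  rw [Finsupp.add_apply]
  linarith

theorem div_one : E.div (1 : E.FunField) = 0 := by
  have := div_mul (E := E) one_ne_zero one_ne_zero
  rwa [mul_one, left_eq_add] at this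

theorem div_inv {h : E.FunField} (hh : h ≠ 0) : E.div h⁻¹ = -E.div h := by
  rw [eq_neg_iff_add_eq_zero, ← div_mul (inv_ne_zero hh) hh, inv_mul_cancel₀ hh, div_one]

theorem div_prod {ι : Type*} (s : Finset ι) {g : ι → E.FunField} (hg : ∀ i, g i ≠ 0) :
    E.div (∏ i ∈ s, g i) = ∑ i ∈ s, E.div (g i) := by
  classical
  induction s using Finset.induction_on with
  | empty => simp [div_one]
  | insert i s hi ih =>
    rw [Finset.prod_insert hi, Finset.sum_insert hi,
      div_mul (hg i) (Finset.prod_ne_zero_iff.mpr fun j _ => hg j), ih]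

variable (E) in
/-- The inclusion of the coordinate ring into the function field. -/
def toField : E.CoordRing →ₐ[F] E.FunField := IsScalarTower.toAlgHom F E.CoordRing E.FunField

theorem toField_apply (u : E.CoordRing) : E.toField u = algebraMap E.CoordRing E.FunField u := rfl

theorem toField_injective : Function.Injective E.toField :=
  IsFractionRing.injective E.CoordRing E.FunField

theorem toField_ne_zero {u : E.CoordRing} (hu : u ≠ 0) : E.toField u ≠ 0 :=
  (map_ne_zero_iff _ toField_injective).mpr hu

theorem single_infty_some (n : ℤ) (v : HeightOneSpectrum E.CoordRing) :
    Finsupp.single E.infty n (some v) = 0 :=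
  Finsupp.single_eq_of_ne (Option.some_ne_none v)

/-- An element of the fraction field of a Dedekind domain that is integral at every prime lies in
the domain; what remains is the condition at `P∞`. -/
theorem RRSpace_single_infty (n : ℕ) :
    E.RRSpace (Finsupp.single E.infty (n : ℤ)) = (E.poleSpace n).map E.toField.toLinearMap := by
  ext g
  rw [mem_RRSpace]
  constructor
  · intro h
    obtain ⟨u, rfl⟩ := HeightOneSpectrum.mem_integers_of_valuation_le_one E.FunField g fun v => by
      have := h (some v)
      rwa [single_infty_some, WithZero.exp_zero] at this
    refine ⟨u, ?_, rfl⟩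
    by_cases hu : u = 0
    · rw [hu]; exact Submodule.zero_mem _
    have := h none
    change E.valInf _ ≤ _ at this
    rw [E.valInf_algebraMap hu, infty, Finsupp.single_eq_same, WithZero.exp_le_exp] at this
    exact_mod_cast this
  · rintro ⟨u, hu, rfl⟩ (_ | v)
    · by_cases hu0 : u = 0
      · simp [hu0]
      change E.valInf (algebraMap E.CoordRing E.FunField u) ≤ _
      rw [E.valInf_algebraMap hu0, infty, Finsupp.single_eq_same, WithZero.exp_le_exp]
      exact_mod_cast hu
    · rw [single_infty_some, WithZero.exp_zero]
      exact HeightOneSpectrum.valuation_le_one v u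

theorem finrank_RRSpace_single_infty {n : ℕ} (hn : 0 < n) :
    finrank F (E.RRSpace (Finsupp.single E.infty (n : ℤ))) = n := by
  rw [RRSpace_single_infty]
  exact ((Submodule.equivMapOfInjective _ toField_injective _).finrank_eq.symm).trans
    (finrank_poleSpace hn)

theorem RRSpace_zero : E.RRSpace 0 = Submodule.span F {1} := by
  have h := RRSpace_single_infty (E := E) 0
  rw [Nat.cast_zero, Finsupp.single_zero] at h
  rw [h]
  ext g
  rw [Submodule.mem_span_singleton]
  constructor
  · rintro ⟨u, hu, rfl⟩
    obtain ⟨c, rfl⟩ := exists_const_of_mem_poleSpace_one (poleSpace_mono zero_le_one hu)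
    exact ⟨c, by rw [AlgHom.toLinearMap_apply, AlgHom.commutes, Algebra.algebraMap_eq_smul_one]⟩
  · rintro ⟨c, rfl⟩
    refine ⟨algebraMap F _ c, algebraMap_mem_poleSpace_zero c, ?_⟩
    rw [AlgHom.toLinearMap_apply, AlgHom.commutes, Algebra.algebraMap_eq_smul_one]

theorem RRSpace_neg_div {h : E.FunField} (hh : h ≠ 0) :
    E.RRSpace (-E.div h) = Submodule.span F {h} := by
  ext g
  rw [← zero_add (-E.div h), ← div_inv hh, mem_RRSpace_add_div (inv_ne_zero hh), RRSpace_zero,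
    Submodule.mem_span_singleton, Submodule.mem_span_singleton]
  refine exists_congr fun c => ?_
  rw [eq_mul_inv_iff_mul_eq₀ hh, smul_mul_assoc, one_mul]

/-! ### The divisor of x - a. -/

/-- The maximal ideal of a rational point `(a, b)` is generated by `x - a` and `y - b`. -/
theorem AffinePoint.place_asIdeal (P : E.AffinePoint) : P.place.asIdeal =
    Ideal.span {algebraMap F[X] E.CoordRing (X - C P.1.1),
      E.y - algebraMap F[X] E.CoordRing (C P.1.2)} := by
  refine le_antisymm (fun u hu => ?_) (Ideal.span_le.mpr ?_)
  · obtain ⟨p, q, rfl⟩ := E.exists_ofPair u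
    have h0 : p.eval P.1.1 + q.eval P.1.1 * P.1.2 = 0 := by
      rw [← P.eval_ofPair]; exact hu
    obtain ⟨r, hr⟩ := X_sub_C_dvd_sub_C_eval (a := P.1.1) (p := p)
    obtain ⟨s, hs⟩ := X_sub_C_dvd_sub_C_eval (a := P.1.1) (p := q)
    rw [Ideal.mem_span_pair]
    refine ⟨algebraMap F[X] E.CoordRing r + algebraMap F[X] E.CoordRing s * E.y,
      algebraMap F[X] E.CoordRing (C (q.eval P.1.1)), ?_⟩
    have h1 := congrArg (algebraMap F[X] E.CoordRing) hr
    have h2 := congrArg (algebraMap F[X] E.CoordRing) hs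
    have h3 := congrArg (fun c => algebraMap F[X] E.CoordRing (C c)) h0
    simp only [map_add, map_mul, map_sub, map_zero] at h1 h2 h3 ⊢
    rw [ofPair_apply, Algebra.smul_def, Algebra.smul_def]
    linear_combination -h1 - E.y * h2 - h3
  · rintro _ (rfl | rfl)
    · change P.eval _ = 0
      rw [P.eval_algebraMap, eval_sub, eval_X, eval_C, sub_self]
    · change P.eval _ = 0
      rw [map_sub, P.eval_algebraMap, P.eval_y, eval_C, sub_self]

theorem AffinePoint.place_injective :
    Function.Injective (AffinePoint.place : E.AffinePoint → HeightOneSpectrum E.CoordRing) := by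
  intro P Q h
  by_contra hne
  obtain ⟨u, hP, hQ⟩ := exists_eval_separating hne
  have h1 : u ∈ Q.place.asIdeal := hQ
  rw [← h] at h1
  exact hP h1

/-- The zeros of `x - a` are the two points `(a, b)` and `(a, -b)`. -/
theorem span_X_sub_C_eq_mul {P Q : E.AffinePoint} (hx : Q.1.1 = P.1.1) (hy : Q.1.2 = -P.1.2)
    (h0 : P.1.2 ≠ 0) : Ideal.span {algebraMap F[X] E.CoordRing (X - C P.1.1)} =
      P.place.asIdeal * Q.place.asIdeal := by
  rw [P.place_asIdeal, Q.place_asIdeal, hx, hy, Ideal.span_pair_mul_span_pair]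
  set z := algebraMap F[X] E.CoordRing (X - C P.1.1) with hz
  set b := algebraMap F[X] E.CoordRing (C P.1.2) with hb
  have hb' : algebraMap F[X] E.CoordRing (C (-P.1.2)) = -b := by rw [map_neg, map_neg]
  rw [hb']
  refine le_antisymm ?_ (Ideal.span_le.mpr ?_)
  · rw [Ideal.span_singleton_le_iff_mem]
    set I := Ideal.span {z * z, z * (E.y - -b), (E.y - b) * z, (E.y - b) * (E.y - -b)} with hI
    have h1 : z * (E.y - -b) ∈ I := Ideal.subset_span (by simp)
    have h2 : (E.y - b) * z ∈ I := Ideal.subset_span (by simp)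
    -- With z = x - a, the difference z (y + b) - (y - b) z is 2 b z, and 2 b is invertible because
    -- b ≠ 0.
    have h3 := I.mul_mem_left (algebraMap F[X] E.CoordRing (C (2 * P.1.2)⁻¹)) (I.sub_mem h1 h2)
    convert h3 using 1
    have h4 : algebraMap F[X] E.CoordRing (C (2 * P.1.2)⁻¹) * (2 * b) = 1 := by
      rw [hb, ← map_ofNat (algebraMap F[X] E.CoordRing) 2, ← map_mul, ← map_mul,
        ← map_ofNat C 2, ← C_mul, ← C_mul, inv_mul_cancel₀ (mul_ne_zero E.two_ne_zero_field h0),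
        C_1, map_one]
    linear_combination -z * h4
  -- The last generator is y² - b² = f(x) - f(a), a multiple of x - a.
  · obtain ⟨r, hr⟩ := X_sub_C_dvd_sub_C_eval (a := P.1.1) (p := E.f)
    have h1 := congrArg (algebraMap F[X] E.CoordRing) hr
    rw [map_sub, map_mul, ← y_sq, ← P.2, C_pow, map_pow, ← hz, ← hb] at h1
    rintro _ (rfl | rfl | rfl | rfl) <;> rw [SetLike.mem_coe, Ideal.mem_span_singleton]
    · exact dvd_mul_right _ _
    · exact dvd_mul_right _ _
    · exact dvd_mul_left _ _
    · exact ⟨algebraMap F[X] E.CoordRing r, by linear_combination h1⟩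

theorem HeightOneSpectrum_eq_of_dvd {v w : HeightOneSpectrum E.CoordRing}
    (h : v.asIdeal ∣ w.asIdeal) : w = v :=
  HeightOneSpectrum.ext (w.isMaximal.eq_of_le v.isPrime.ne_top (Ideal.dvd_iff_le.mp h))

/-- P divides (z) = P Q, while P² ∣ P Q would give P ∣ Q and hence P = Q. -/
theorem intValuation_eq_exp_neg_one {P Q : HeightOneSpectrum E.CoordRing} (h : P ≠ Q)
    {z : E.CoordRing} (hz : Ideal.span {z} = P.asIdeal * Q.asIdeal) :
    P.intValuation z = WithZero.exp (-1) := by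
  have h0 : z ≠ 0 := by
    rintro rfl
    rw [Ideal.span_singleton_zero, eq_comm, ← Ideal.zero_eq_bot] at hz
    exact (mul_ne_zero P.ne_bot Q.ne_bot) hz
  have h1 : P.intValuation z ≤ WithZero.exp (-((1 : ℕ) : ℤ)) := by
    rw [P.intValuation_le_pow_iff_dvd, hz, pow_one]
    exact dvd_mul_right _ _
  have h2 : ¬ P.intValuation z ≤ WithZero.exp (-((2 : ℕ) : ℤ)) := by
    rw [P.intValuation_le_pow_iff_dvd, hz, pow_two]
    intro h2
    exact h (HeightOneSpectrum_eq_of_dvd ((mul_dvd_mul_iff_left P.ne_bot).mp h2)).symm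
  have h3 : P.intValuation z ≠ 0 := (P.intValuation_ne_zero _ h0)
  rw [← WithZero.exp_log h3, WithZero.exp_le_exp] at h1 h2
  rw [← WithZero.exp_log h3, WithZero.exp_inj]
  push_cast at h1 h2
  omega

theorem div_X_sub_C {P Q : E.AffinePoint} (hx : Q.1.1 = P.1.1) (hy : Q.1.2 = -P.1.2)
    (h0 : P.1.2 ≠ 0) : E.div (E.toField (algebraMap F[X] E.CoordRing (X - C P.1.1))) =
      Finsupp.single (some P.place) 1 + Finsupp.single (some Q.place) 1 -
        Finsupp.single E.infty 2 := by
  have hspan := span_X_sub_C_eq_mul hx hy h0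
  have hPQ : P ≠ Q := by
    rintro rfl
    have : 2 * P.1.2 = 0 := by linear_combination hy
    exact mul_ne_zero E.two_ne_zero_field h0 this
  have hpl : P.place ≠ Q.place := AffinePoint.place_injective.ne hPQ
  have hz : algebraMap F[X] E.CoordRing (X - C P.1.1) ≠ 0 := by
    rw [Ne, FaithfulSMul.algebraMap_eq_zero_iff]
    exact X_sub_C_ne_zero _
  set z := algebraMap F[X] E.CoordRing (X - C P.1.1) with hzdef
  have key (v : E.Place) (k : ℤ) (h : E.placeVal v (E.toField z) = WithZero.exp (-k)) :
      E.div (E.toField z) v = k := by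
    rw [placeVal_eq_exp (toField_ne_zero hz), WithZero.exp_inj] at h
    linarith
  ext v
  apply key
  rcases v with _ | v
  · change E.valInf _ = _
    rw [toField_apply, E.valInf_algebraMap hz, hzdef, Algebra.algebraMap_eq_smul_one,
      ← add_zero (_ • (1 : E.CoordRing)), ← zero_smul F[X] E.y, norm_repr]
    simp [infty]
  · change v.valuation E.FunField (algebraMap E.CoordRing E.FunField z) = _
    rw [HeightOneSpectrum.valuation_of_algebraMap]
    by_cases hvP : v = P.place
    · subst hvP
      rw [intValuation_eq_exp_neg_one hpl hspan]
      simp [infty, hpl.symm]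
    by_cases hvQ : v = Q.place
    · subst hvQ
      rw [intValuation_eq_exp_neg_one hpl.symm (hspan.trans (mul_comm _ _))]
      simp [infty, hpl]
    have h1 : v.intValuation z = 1 := by
      refine le_antisymm (v.intValuation_le_one z) (not_lt.mp fun h => ?_)
      rw [v.intValuation_lt_one_iff_dvd, hspan, v.prime.dvd_mul] at h
      rcases h with h | h
      · exact hvP (HeightOneSpectrum_eq_of_dvd h).symm
      · exact hvQ (HeightOneSpectrum_eq_of_dvd h).symm
    rw [h1]
    simp [infty, Ne.symm hvP, Ne.symm hvQ]

end EllipticCurve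

/-! ### The functions h_ℓ and their Riemann–Roch spaces. -/

namespace EllipticCurve

open Polynomial IsDedekindDomain Module

variable {F : Type u} [Field F] {E : EllipticCurve F}

namespace InterpPoints

variable {J : ℕ} (I : E.InterpPoints J)

theorem lin_eq (j : Fin J) :
    I.lin j = E.toField (algebraMap F[X] E.CoordRing (X - C (I.α j))) := by
  rw [lin, IsScalarTower.algebraMap_apply F F[X] E.CoordRing, map_sub (algebraMap F[X] _)]
  rfl

theorem lin_ne_zero (j : Fin J) : I.lin j ≠ 0 := by
  rw [lin_eq]
  refine toField_ne_zero ?_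
  rw [Ne, FaithfulSMul.algebraMap_eq_zero_iff]
  exact X_sub_C_ne_zero _

theorem prod_lin_ne_zero (s : Finset (Fin J)) : ∏ j ∈ s, I.lin j ≠ 0 :=
  Finset.prod_ne_zero_iff.mpr fun j _ => I.lin_ne_zero j

/-- The polynomial `∏_j (x - α j)`. -/
def den : F[X] := ∏ j, (X - C (I.α j))

/-- The polynomial `∏_{j' ∈ [J] ∖ j} (x - α j')`. -/
def num1 (j : Fin J) : F[X] := ∏ j' ∈ Finset.univ.erase j, (X - C (I.α j'))

/-- The polynomial `∏_{j' ∈ [J - 1] ∖ j} (x - α j')`. -/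
def num2 (j : Fin (J - 1)) : F[X] :=
  ∏ j' ∈ Finset.univ.erase j, (X - C (I.α (Fin.castLE (Nat.sub_le J 1) j')))

/-- The numerators of the functions `h_ℓ` with respect to the common denominator `den`. -/
def num : Fin J ⊕ Fin (J - 1) → E.CoordRing :=
  Sum.elim (fun j => E.ofPair (I.num1 j, 0)) fun j => E.ofPair (0, I.num2 j)

theorem toField_den : E.toField (algebraMap F[X] E.CoordRing I.den) = ∏ j, I.lin j := by
  rw [den, map_prod, map_prod]
  exact Finset.prod_congr rfl fun j _ => (I.lin_eq j).symm

theorem toField_num1 (j : Fin J) : E.toField (algebraMap F[X] E.CoordRing (I.num1 j)) =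
    ∏ j' ∈ Finset.univ.erase j, I.lin j' := by
  rw [num1, map_prod, map_prod]
  exact Finset.prod_congr rfl fun j _ => (I.lin_eq j).symm

theorem toField_num2 (j : Fin (J - 1)) : E.toField (algebraMap F[X] E.CoordRing (I.num2 j)) =
    ∏ j' ∈ Finset.univ.erase j, I.lin (Fin.castLE (Nat.sub_le J 1) j') := by
  rw [num2, map_prod, map_prod]
  exact Finset.prod_congr rfl fun j _ => (I.lin_eq _).symm

theorem interp_mul_den (ℓ : Fin J ⊕ Fin (J - 1)) :
    I.interp ℓ * E.toField (algebraMap F[X] E.CoordRing I.den) = E.toField (I.num ℓ) := by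
  have h0 := I.prod_lin_ne_zero Finset.univ
  rw [toField_den]
  rcases ℓ with j | j
  · change I.h * _ * _ = E.toField (E.ofPair (I.num1 j, 0))
    rw [← algebraMap_eq_ofPair, toField_num1, h, mul_right_comm, inv_mul_cancel₀ h0, one_mul]
  · change I.h * E.toField E.y * _ * _ = E.toField (E.ofPair (0, I.num2 j))
    have e : E.ofPair (0, I.num2 j) = E.y * algebraMap F[X] E.CoordRing (I.num2 j) := by
      rw [ofPair_apply, zero_smul, zero_add, Algebra.smul_def, mul_comm]
    rw [e, map_mul, toField_num2, h, mul_right_comm, mul_right_comm _ _ (∏ j, I.lin j),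
      inv_mul_cancel₀ h0, one_mul]

theorem den_ne_zero : I.den ≠ 0 := Finset.prod_ne_zero_iff.mpr fun _ _ => X_sub_C_ne_zero _

theorem toField_den_ne_zero : E.toField (algebraMap F[X] E.CoordRing I.den) ≠ 0 := by
  rw [toField_den]; exact I.prod_lin_ne_zero _

theorem eval_den_α (j : Fin J) : I.den.eval (I.α j) = 0 := by
  rw [den, eval_prod]
  exact Finset.prod_eq_zero (Finset.mem_univ j) (by simp)

theorem eval_den_ne_zero {a : F} (ha : ∀ j, a ≠ I.α j) : I.den.eval a ≠ 0 := by
  rw [den, eval_prod, Finset.prod_ne_zero_iff]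
  intro j _
  simpa [sub_eq_zero] using ha j

theorem natDegree_den : I.den.natDegree = J := by
  rw [den, natDegree_prod_of_monic _ _ fun j _ => monic_X_sub_C _]
  simp

theorem natDegree_num1 (j : Fin J) : (I.num1 j).natDegree = J - 1 := by
  rw [num1, natDegree_prod_of_monic _ _ fun j _ => monic_X_sub_C _]
  simp

theorem natDegree_num2 (j : Fin (J - 1)) : (I.num2 j).natDegree = J - 1 - 1 := by
  rw [num2, natDegree_prod_of_monic _ _ fun j _ => monic_X_sub_C _]
  simp

theorem num_mem_poleSpace (ℓ : Fin J ⊕ Fin (J - 1)) : I.num ℓ ∈ E.poleSpace (2 * J - 1) := by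
  rcases ℓ with j | j
  · change E.ofPair (I.num1 j, 0) ∈ _
    rw [← algebraMap_eq_ofPair]
    have := j.isLt
    exact algebraMap_mem_poleSpace (by rw [natDegree_num1]; omega)
  · change E.ofPair (0, I.num2 j) ∈ _
    have := j.isLt
    rw [ofPair_mem_poleSpace, mem_degreeLT, mem_degreeLT]
    refine ⟨by rw [degree_zero]; exact WithBot.bot_lt_coe _, degree_le_natDegree.trans_lt ?_⟩
    rw [natDegree_num2]
    norm_cast; omega

theorem eval_num1 (i j : Fin J) : (I.num1 i).eval (I.α j) = 0 ↔ i ≠ j := by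
  rw [num1, eval_prod, Finset.prod_eq_zero_iff]
  simp only [Finset.mem_erase, Finset.mem_univ, and_true, eval_sub, eval_X, eval_C, sub_eq_zero,
    I.α_injective.eq_iff]
  constructor
  · rintro ⟨a, ha, rfl⟩; exact ha.symm
  · exact fun h => ⟨j, h.symm, rfl⟩

theorem eval_num2 (i j : Fin (J - 1)) :
    (I.num2 i).eval (I.α (Fin.castLE (Nat.sub_le J 1) j)) = 0 ↔ i ≠ j := by
  rw [num2, eval_prod, Finset.prod_eq_zero_iff]
  simp only [Finset.mem_erase, Finset.mem_univ, and_true, eval_sub, eval_X, eval_C, sub_eq_zero,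
    I.α_injective.eq_iff, (Fin.castLE_injective (Nat.sub_le J 1)).eq_iff]
  constructor
  · rintro ⟨a, ha, rfl⟩; exact ha.symm
  · exact fun h => ⟨j, h.symm, rfl⟩

/-- A combination of the numerators is determined by its values at the points `P j`, `P̄ j`. -/
theorem eq_zero_of_eval_sum_num {c : Fin J ⊕ Fin (J - 1) → F}
    (h : ∀ j, (I.P j).eval (∑ ℓ, c ℓ • I.num ℓ) = 0)
    (h' : ∀ j, (I.Pbar j).eval (∑ ℓ, c ℓ • I.num ℓ) = 0) : c = 0 := by
  have e : ∑ ℓ, c ℓ • I.num ℓ =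
      E.ofPair (∑ j, c (.inl j) • I.num1 j, ∑ j, c (.inr j) • I.num2 j) := by
    rw [Fintype.sum_sum_type]
    change ∑ j, c (.inl j) • E.ofPair (I.num1 j, 0) + ∑ j, c (.inr j) • E.ofPair (0, I.num2 j) = _
    simp only [ofPair_apply, zero_smul, add_zero, zero_add, Finset.sum_smul, smul_assoc]
  rw [e] at h h'
  have h (j : Fin J) : (∑ i, c (.inl i) • I.num1 i).eval (I.α j) +
      (∑ i, c (.inr i) • I.num2 i).eval (I.α j) * I.β j = 0 :=
    ((I.P j).eval_ofPair _ _).symm.trans (h j)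
  have h' (j : Fin J) : (∑ i, c (.inl i) • I.num1 i).eval (I.α j) +
      (∑ i, c (.inr i) • I.num2 i).eval (I.α j) * -I.β j = 0 :=
    ((I.Pbar j).eval_ofPair _ _).symm.trans (h' j)
  -- The values at P_j and P̄_j separate the part in x from the coefficient of y. Up to scaling,
  -- `num1` and `num2` are Lagrange bases at J and J - 1 abscissas, so each coefficient can be read
  -- off.
  have hp (j : Fin J) : (∑ i, c (.inl i) • I.num1 i).eval (I.α j) = 0 := by
    have h1 := h j
    have h2 := h' j
    have h3 : 2 * (∑ i, c (.inl i) • I.num1 i).eval (I.α j) = 0 := by linear_combination h1 + h2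
    exact (mul_eq_zero.mp h3).resolve_left E.two_ne_zero_field
  have hq (j : Fin J) : (∑ i, c (.inr i) • I.num2 i).eval (I.α j) = 0 := by
    have h1 := h j
    rw [hp j, zero_add] at h1
    exact (mul_eq_zero.mp h1).resolve_right (I.β_ne_zero j)
  funext ℓ
  rcases ℓ with j | j
  · have h1 := hp j
    rw [eval_finsetSum, Finset.sum_eq_single j] at h1
    · rw [eval_smul, smul_eq_mul] at h1
      exact (mul_eq_zero.mp h1).resolve_right fun h0 => (I.eval_num1 j j).mp h0 rfl
    · intro i _ hij
      rw [eval_smul, (I.eval_num1 i j).mpr hij, smul_zero]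
    · simp
  · have h1 := hq (Fin.castLE (Nat.sub_le J 1) j)
    rw [eval_finsetSum, Finset.sum_eq_single j] at h1
    · rw [eval_smul, smul_eq_mul] at h1
      exact (mul_eq_zero.mp h1).resolve_right fun h0 => (I.eval_num2 j j).mp h0 rfl
    · intro i _ hij
      rw [eval_smul, (I.eval_num2 i j).mpr hij, smul_zero]
    · simp

theorem sum_interp_mul_den (c : Fin J ⊕ Fin (J - 1) → F) :
    (∑ ℓ, c ℓ • I.interp ℓ) * E.toField (algebraMap F[X] E.CoordRing I.den) =
      E.toField (∑ ℓ, c ℓ • I.num ℓ) := by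
  rw [Finset.sum_mul, map_sum]
  exact Finset.sum_congr rfl fun ℓ _ => by rw [smul_mul_assoc, interp_mul_den, map_smul]

theorem linearIndependent_interp : LinearIndependent F I.interp := by
  rw [Fintype.linearIndependent_iff]
  intro c hc
  have h1 := I.sum_interp_mul_den c
  rw [hc, zero_mul, eq_comm, map_eq_zero_iff _ toField_injective] at h1
  exact congrFun (I.eq_zero_of_eval_sum_num (by simp [h1]) (by simp [h1]))

/-- Each x - α_j has a double pole at `P∞`, so the denominator contributes -2J there. The truncated
2J - 1 needs J > 0. -/
theorem divInfo_eq (hJ : 0 < J) : I.divInfo = Finsupp.single E.infty ((2 * J - 1 : ℕ) : ℤ) +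
    E.div (E.toField (algebraMap F[X] E.CoordRing I.den)) := by
  rw [toField_den, div_prod _ I.lin_ne_zero]
  have h1 (j : Fin J) : E.div (I.lin j) = Finsupp.single (some (I.P j).place) 1 +
      Finsupp.single (some (I.Pbar j).place) 1 - Finsupp.single E.infty 2 := by
    rw [lin_eq]
    exact div_X_sub_C (P := I.P j) (Q := I.Pbar j) rfl rfl (I.β_ne_zero j)
  simp only [h1]
  rw [Finset.sum_sub_distrib, divInfo, Finset.sum_const, Finset.card_univ, Fintype.card_fin,
    Finsupp.smul_single, add_sub_left_comm, ← Finsupp.single_sub, sub_eq_add_neg,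
    ← Finsupp.single_neg]
  congr 2
  rw [nsmul_eq_mul]
  push_cast [Nat.cast_sub (show 1 ≤ 2 * J by omega)]
  ring

/-- Independence of 2J - 1 functions in a space of dimension 2J - 1. -/
theorem span_interp (hJ : 0 < J) :
    Submodule.span F (Set.range I.interp) = E.RRSpace I.divInfo := by
  have hfin : finrank F (E.RRSpace I.divInfo) = 2 * J - 1 := by
    rw [I.divInfo_eq hJ, finrank_RRSpace_add_div _ I.toField_den_ne_zero,
      finrank_RRSpace_single_infty (by omega)]
  have : FiniteDimensional F (E.RRSpace I.divInfo) := .of_finrank_pos (by omega)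
  refine Submodule.eq_of_le_of_finrank_eq (Submodule.span_le.mpr ?_) ?_
  · rintro _ ⟨ℓ, rfl⟩
    rw [I.divInfo_eq hJ, SetLike.mem_coe, mem_RRSpace_add_div I.toField_den_ne_zero,
      interp_mul_den, RRSpace_single_infty]
    exact ⟨_, I.num_mem_poleSpace ℓ, rfl⟩
  · rw [hfin, finrank_span_eq_card I.linearIndependent_interp]
    simp only [Fintype.card_sum, Fintype.card_fin]
    omega

theorem interp_ne_zero (ℓ : Fin J ⊕ Fin (J - 1)) : I.interp ℓ ≠ 0 :=
  I.linearIndependent_interp.ne_zero ℓ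

/-- The quotient `y / h_ℓ` is regular on the affine curve. -/
theorem exists_mul_interp_eq_y (ℓ : Fin J ⊕ Fin (J - 1)) :
    ∃ r ∈ E.poleSpace 5, E.toField r * I.interp ℓ = E.toField E.y := by
  have h0 := I.toField_den_ne_zero
  rcases ℓ with j | j
  -- Here y / h_j⁽¹⁾ = y (x - α_j), of pole order 3 + 2.
  · refine ⟨E.y * algebraMap F[X] E.CoordRing (X - C (I.α j)),
      mul_mem_poleSpace (n := 2) y_mem_poleSpace (algebraMap_mem_poleSpace (by simp)), ?_⟩
    apply mul_right_cancel₀ h0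
    rw [mul_assoc, interp_mul_den]
    change _ * E.toField (E.ofPair (I.num1 j, 0)) = _
    rw [← algebraMap_eq_ofPair, ← map_mul, ← map_mul, mul_assoc, ← map_mul, num1,
      Finset.mul_prod_erase _ (fun j => X - C (I.α j)) (Finset.mem_univ j)]
    rfl
  · have hJ : J - 1 < J := by have := j.isLt; omega
    -- The product in h_j⁽²⁾ also omits the last abscissa, so y / h_j⁽²⁾ is a product of two linear
    -- factors, of pole order 4.
    let k : Fin J := ⟨J - 1, hJ⟩
    refine ⟨algebraMap F[X] E.CoordRing
      ((X - C (I.α (Fin.castLE (Nat.sub_le J 1) j))) * (X - C (I.α k))),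
      algebraMap_mem_poleSpace ?_, ?_⟩
    · rw [natDegree_mul (X_sub_C_ne_zero _) (X_sub_C_ne_zero _), natDegree_X_sub_C,
        natDegree_X_sub_C]
      norm_num
    apply mul_right_cancel₀ h0
    rw [mul_assoc, interp_mul_den]
    change _ * E.toField (E.ofPair (0, I.num2 j)) = _
    have e : E.ofPair (0, I.num2 j) = algebraMap F[X] E.CoordRing (I.num2 j) * E.y := by
      rw [ofPair_apply, zero_smul, zero_add, Algebra.smul_def]
    have hden : (X - C (I.α (Fin.castLE (Nat.sub_le J 1) j))) * (X - C (I.α k)) * I.num2 j =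
        I.den := by
      rw [mul_right_comm, num2, Finset.mul_prod_erase _
        (fun j => X - C (I.α (Fin.castLE (Nat.sub_le J 1) j))) (Finset.mem_univ j), den]
      obtain ⟨K, rfl⟩ : ∃ K, J = K + 1 := ⟨J - 1, by omega⟩
      rw [Fin.prod_univ_castSucc]
      rfl
    rw [e, ← map_mul, ← mul_assoc, ← map_mul, hden, ← map_mul, mul_comm E.y]

theorem finrank_RRSpace_divSec (X : ℕ) (ℓ : Fin J ⊕ Fin (J - 1)) :
    finrank F (E.RRSpace (I.divSec X ℓ)) = X + 1 := by
  rw [divSec, finrank_RRSpace_add_div _ (I.interp_ne_zero ℓ)]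
  exact_mod_cast finrank_RRSpace_single_infty (E := E) X.succ_pos

theorem mem_RRSpace_divSec {X : ℕ} {ℓ : Fin J ⊕ Fin (J - 1)} {g : E.FunField} :
    g ∈ E.RRSpace (I.divSec X ℓ) ↔ ∃ u ∈ E.poleSpace (X + 1), E.toField u = g * I.interp ℓ := by
  have h := RRSpace_single_infty (E := E) (X + 1)
  rw [Nat.cast_add, Nat.cast_one] at h
  rw [divSec, mem_RRSpace_add_div (I.interp_ne_zero ℓ), h]
  rfl

end InterpPoints

theorem mem_RRSpace_divPriv {T : ℕ} {g : E.FunField} :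
    g ∈ E.RRSpace (E.divPriv T) ↔ ∃ u ∈ E.poleSpace (T + 1), E.toField u = g := by
  have h := RRSpace_single_infty (E := E) (T + 1)
  rw [Nat.cast_add, Nat.cast_one] at h
  rw [divPriv, h]
  rfl

theorem finrank_RRSpace_divPriv (T : ℕ) : finrank F (E.RRSpace (E.divPriv T)) = T + 1 := by
  exact_mod_cast finrank_RRSpace_single_infty (E := E) T.succ_pos

end EllipticCurve

/-! ### Security, privacy and correctness over an abstract algebra. -/

namespace PIRScheme

theorem prob_congr {Ω : Type u} {p p' : Ω → Prop} (e : Ω ≃ Ω) (h : ∀ ω, p ω ↔ p' (e ω)) :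
    prob p = prob p' := by
  rw [prob, prob, Nat.card_congr (e.subtypeEquiv h)]

section ofAlgebra

variable {F : Type u} [Field F] {A : Type u} [CommRing A] [Algebra F A] {ι : Type} [Fintype ι]
  {M N : ℕ} {Vsec Vpriv : ι → Submodule F A} {h : ι → A} {φ : A →ₐ[F] (Fin N → F)}

/-- One-time pad: translating the noise by elements with the right values on S turns the shares of W
into those of W', and a translation preserves the uniform distribution. -/
theorem isSecure_ofAlgebra {enc : F →ₗ[F] A} {X : ℕ}
    (hsec : ∀ S : Finset (Fin N), S.card ≤ X → ∀ (ℓ : ι) (t : Fin N → F),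
      ∃ δ ∈ Vsec ℓ, ∀ n ∈ S, φ δ n = t n) :
    (ofAlgebra M enc Vsec h Vpriv φ).IsSecure X := by
  intro S hS W W' s
  choose δ hδ hδφ using fun (ℓ : ι) (m : Fin M) => hsec S hS ℓ (φ (enc (W m ℓ) - enc (W' m ℓ)))
  let d : (ℓ : ι) → Fin M → Vsec ℓ := fun ℓ m => ⟨δ ℓ m, hδ ℓ m⟩
  let e : ((ℓ : ι) → Fin M → Vsec ℓ) ≃ ((ℓ : ι) → Fin M → Vsec ℓ) := Equiv.addRight d
  refine prob_congr e fun ω => ?_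
  refine Eq.congr (funext fun n => funext fun ℓ => funext fun m => ?_) rfl
  change φ (enc (W m ℓ) + ω ℓ m) n = φ (enc (W' m ℓ) + ((ω ℓ m : A) + δ ℓ m)) n
  have h1 := hδφ ℓ m n n.2
  rw [map_sub, Pi.sub_apply] at h1
  simp only [map_add, Pi.add_apply]
  rw [h1]
  ring

/-- The same translation argument for the query noise, with the storage randomness fixed. Answers
are functions of shares and queries, so the whole views agree. -/
theorem isPrivate_ofAlgebra {enc : F →ₗ[F] A} {T : ℕ}
    (hpriv : ∀ S : Finset (Fin N), S.card ≤ T → ∀ (ℓ : ι) (t : Fin N → F),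
      ∃ δ ∈ Vpriv ℓ, ∀ n ∈ S, φ δ n = t n) :
    (ofAlgebra M enc Vsec h Vpriv φ).IsPrivate T := by
  intro S hS W θ θ' v
  choose δ hδ hδφ using fun (ℓ : ι) (m : Fin M) =>
    hpriv S hS ℓ (φ ((if m = θ then h ℓ else 0) - if m = θ' then h ℓ else 0))
  let d : (ℓ : ι) → Fin M → Vpriv ℓ := fun ℓ m => ⟨δ ℓ m, hδ ℓ m⟩
  let e : ((ℓ : ι) → Fin M → Vpriv ℓ) ≃ ((ℓ : ι) → Fin M → Vpriv ℓ) := Equiv.addRight d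
  refine prob_congr ((Equiv.refl _).prodCongr e) fun r => ?_
  refine Eq.congr (funext fun n => ?_) rfl
  have hq : (ofAlgebra M enc Vsec h Vpriv φ).query θ r.2 n =
      (ofAlgebra M enc Vsec h Vpriv φ).query θ' (e r.2) n := by
    funext ℓ m
    change φ ((if m = θ then h ℓ else 0) + r.2 ℓ m) n =
      φ ((if m = θ' then h ℓ else 0) + ((r.2 ℓ m : A) + δ ℓ m)) n
    have h1 := hδφ ℓ m n n.2
    rw [map_sub, Pi.sub_apply] at h1
    rw [map_add, map_add, map_add, Pi.add_apply, Pi.add_apply, Pi.add_apply, h1]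
    ring
  rw [view, hq]
  rfl

/-- Multiplicativity of φ makes each answer a coordinate of φ at one element of A, split here into
the desired signal and the noise. -/
theorem answer_ofAlgebra {enc : F →ₗ[F] A} (W : Fin M → ι → F) (θ : Fin M)
    (ω : (ℓ : ι) → Fin M → Vsec ℓ) (η : (ℓ : ι) → Fin M → Vpriv ℓ) (n : Fin N) :
    ((ofAlgebra M enc Vsec h Vpriv φ).answer n ((ofAlgebra M enc Vsec h Vpriv φ).store W ω n)
      ((ofAlgebra M enc Vsec h Vpriv φ).query θ η n) : F) =
    φ (∑ ℓ, enc (W θ ℓ) * h ℓ + (∑ ℓ, (ω ℓ θ : A) * h ℓ +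
      ∑ ℓ, ∑ m, (enc (W m ℓ) + ω ℓ m) * (η ℓ m : A))) n := by
  have e : ∑ ℓ, ∑ m, (enc (W m ℓ) + ω ℓ m) * ((if m = θ then h ℓ else 0) + η ℓ m) =
      ∑ ℓ, enc (W θ ℓ) * h ℓ + (∑ ℓ, (ω ℓ θ : A) * h ℓ +
        ∑ ℓ, ∑ m, (enc (W m ℓ) + ω ℓ m) * (η ℓ m : A)) := by
    rw [← add_assoc, ← Finset.sum_add_distrib, ← Finset.sum_add_distrib]
    refine Finset.sum_congr rfl fun ℓ _ => ?_
    simp only [mul_add, Finset.sum_add_distrib, mul_ite, mul_zero, Finset.sum_ite_eq',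
      Finset.mem_univ, if_true, add_mul]
  rw [← e]
  change ∑ ℓ, ∑ m, φ (enc (W m ℓ) + ω ℓ m) n * φ ((if m = θ then h ℓ else 0) + η ℓ m) n = _
  simp only [map_sum, map_mul, Finset.sum_apply, Pi.mul_apply]

/-- The scheme is correct if a space that contains the noise meets the span of the `h ℓ` trivially,
even after the evaluation. -/
theorem isCorrect_ofAlgebra (V : Submodule F A) (hg : ∀ ℓ, Vpriv ℓ ≤ V)
    (hf : ∀ ℓ, ∀ f ∈ Vsec ℓ, f * h ℓ ∈ V) (hfg : ∀ ℓ, ∀ f ∈ Vsec ℓ, ∀ g ∈ Vpriv ℓ, f * g ∈ V)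
    (hV : ∀ (c : ι → F), ∀ v ∈ V, φ (∑ ℓ, c ℓ • h ℓ + v) = 0 → c = 0) :
    (ofAlgebra M (Algebra.linearMap F A) Vsec h Vpriv φ).IsCorrect := by
  classical
  let S := ofAlgebra M (Algebra.linearMap F A) Vsec h Vpriv φ
  let noise (W : Fin M → ι → F) (θ : Fin M) (ω : S.StoreRand) (η : S.QueryRand) : A :=
    ∑ ℓ, (ω ℓ θ : A) * h ℓ +
      ∑ ℓ, ∑ m, (Algebra.linearMap F A (W m ℓ) + ω ℓ m) * (η ℓ m : A)
  have hnoise (W θ ω η) : noise W θ ω η ∈ V := by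
    refine V.add_mem (V.sum_mem fun ℓ _ => hf ℓ _ (ω ℓ θ).2)
      (V.sum_mem fun ℓ _ => V.sum_mem fun m _ => ?_)
    rw [add_mul, Algebra.linearMap_apply, ← Algebra.smul_def]
    exact V.add_mem (V.smul_mem _ (hg ℓ (η ℓ m).2)) (hfg ℓ _ (ω ℓ m).2 _ (η ℓ m).2)
  -- Subtracting two runs with equal answers gives an element of ker φ of the form ∑ (W θ - W' θ) ℓ
  -- • h ℓ + v with v in V, so `hV` applies.
  have key (W W' θ ω ω' η η') (hans : ∀ n, S.answer n (S.store W ω n) (S.query θ η n) =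
      S.answer n (S.store W' ω' n) (S.query θ η' n)) : W θ = W' θ := by
    rw [← sub_eq_zero]
    refine hV _ (noise W θ ω η - noise W' θ ω' η') (V.sub_mem (hnoise ..) (hnoise ..))
      (funext fun n => ?_)
    have h1 : (_ : F) = _ := (answer_ofAlgebra W θ ω η n).symm.trans
      ((hans n).trans (answer_ofAlgebra W' θ ω' η' n))
    rw [← sub_eq_zero, ← Pi.sub_apply, ← map_sub] at h1
    refine Eq.trans ?_ h1
    have e : ∑ ℓ, (W θ - W' θ) ℓ • h ℓ =
        ∑ ℓ, Algebra.linearMap F A (W θ ℓ) * h ℓ - ∑ ℓ, Algebra.linearMap F A (W' θ ℓ) * h ℓ := by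
      rw [← Finset.sum_sub_distrib]
      refine Finset.sum_congr rfl fun ℓ _ => ?_
      rw [Pi.sub_apply, Algebra.smul_def, map_sub, sub_mul]
      rfl
    rw [e]
    exact congrFun (congrArg φ (sub_add_sub_comm ..)) n
  let good (θ : Fin M) (q : Fin N → S.Query) (a : Fin N → S.Answer) (w : ι → F) : Prop :=
    ∃ W ω η, W θ = w ∧ S.query θ η = q ∧ (fun n => S.answer n (S.store W ω n) (q n)) = a
  -- The decoder picks any file compatible with the transcript; the default 0 never occurs in an
  -- actual run.
  refine ⟨fun θ q a => if H : ∃ w, good θ q a w then H.choose else 0, fun W θ ω η => ?_⟩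
  have H : ∃ w, good θ (S.query θ η) (fun n => S.answer n (S.store W ω n) (S.query θ η n)) w :=
    ⟨W θ, W, ω, η, rfl, rfl, rfl⟩
  refine (dif_pos H).trans ?_
  obtain ⟨W', ω', η', h1, h2, h3⟩ := H.choose_spec
  rw [← h1]
  refine key W' W θ ω' ω η' η fun n => ?_
  rw [h2]
  exact congrFun h3 n

theorem rate_ofAlgebra [Finite F] {enc : F →ₗ[F] A} :
    (ofAlgebra M enc Vsec h Vpriv φ).rate = (Fintype.card ι : ℝ) / N := by
  have hq : Real.log (Nat.card F) ≠ 0 :=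
    (Real.log_pos (by exact_mod_cast Finite.one_lt_card)).ne'
  change Real.log (Nat.card (ι → F)) / (N * Real.log (Nat.card F)) = _
  rw [Nat.card_fun, Nat.card_eq_fintype_card (α := ι), Nat.cast_pow, Real.log_pow,
    mul_div_mul_right _ _ hq]

end ofAlgebra

end PIRScheme

/-! ### The algebra A, the noise space and decoding. -/

namespace EllipticCurve

open Polynomial IsDedekindDomain Module

variable {F : Type u} [Field F] {E : EllipticCurve F} {N : ℕ} {R : Fin N → E.AffinePoint}

theorem mem_regularAlg {g : E.FunField} {u v : E.CoordRing} (hv : v ∈ nonvanishing R)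
    (h : g * E.toField v = E.toField u) : g ∈ regularAlg R :=
  ⟨u, v, hv, (eq_mul_inv_iff_mul_eq₀ (toField_ne_zero hv.1)).mpr h⟩

theorem evalMap_algebraMap (u : E.CoordRing) (n : Fin N) :
    evalMap R (algebraMap E.CoordRing (regularAlg R) u) n = (R n).eval u :=
  congrFun (IsLocalization.lift_eq (M := nonvanishing R)
    (g := (AlgHom.pi fun i => (R i).eval : E.CoordRing →ₐ[F] (Fin N → F)).toRingHom) _ u) n

/-- Values of elements of A are computed by clearing denominators. -/
theorem evalMap_mul_eval {g : regularAlg R} {u v : E.CoordRing}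
    (h : (g : E.FunField) * E.toField v = E.toField u) (n : Fin N) :
    evalMap R g n * (R n).eval v = (R n).eval u := by
  rw [← evalMap_algebraMap, ← evalMap_algebraMap, ← Pi.mul_apply, ← map_mul]
  exact congrFun (congrArg (evalMap R) (Subtype.ext h)) n

theorem RRSpace_divPriv_le (T : ℕ) :
    E.RRSpace (E.divPriv T) ≤ (regularAlg R).toSubmodule := by
  intro g hg
  obtain ⟨u, -, hu⟩ := mem_RRSpace_divPriv.mp hg
  refine mem_regularAlg (u := u) (nonvanishing R).one_mem ?_
  rw [map_one, mul_one, hu]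

theorem exists_mem_divPriv_evalMap_eq (hR : Function.Injective R) {T : ℕ} (S : Finset (Fin N))
    (hS : S.card ≤ T) (t : Fin N → F) :
    ∃ δ ∈ RRSpaceIn R (E.divPriv T), ∀ n ∈ S, evalMap R δ n = t n := by
  obtain ⟨u, hu, hut⟩ := exists_mem_poleSpace_eval_eq (Q := fun n : S => R n)
    (hR.comp Subtype.val_injective) (n := T + 1) (by simpa using Nat.lt_succ_of_le hS)
    (fun n => t n)
  refine ⟨algebraMap E.CoordRing (regularAlg R) u, mem_RRSpace_divPriv.mpr ⟨u, hu, rfl⟩,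
    fun n hn => ?_⟩
  rw [evalMap_algebraMap]
  exact hut ⟨n, hn⟩

theorem finite_RRSpaceIn [Finite F] {D : E.Divisor} (hD : 0 < finrank F (E.RRSpace D)) :
    Finite (RRSpaceIn R D) := by
  have : FiniteDimensional F (E.RRSpace D) := .of_finrank_pos hD
  have : Finite (E.RRSpace D) := Module.finite_of_finite F
  exact Finite.of_injective (fun g : RRSpaceIn R D => (⟨g.1.1, g.2⟩ : E.RRSpace D))
    fun a b h => Subtype.ext (Subtype.ext
      (congrArg (Subtype.val : E.RRSpace D → E.FunField) h))

/-- The functions `v` in `A` such that `y v` is regular on the affine curve with a pole of order at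
most `m` at infinity. -/
def noiseSpace (R : Fin N → E.AffinePoint) (m : ℕ) : Submodule F (regularAlg R) :=
  ((E.poleSpace m).map E.toField.toLinearMap).comap
    (LinearMap.mulLeft F (E.toField E.y) ∘ₗ (regularAlg R).val.toLinearMap)

theorem mem_noiseSpace {m : ℕ} {v : regularAlg R} : v ∈ noiseSpace R m ↔
    ∃ w ∈ E.poleSpace m, E.toField w = E.toField E.y * (v : E.FunField) := Iff.rfl

theorem divPriv_le_noiseSpace (X T : ℕ) :
    RRSpaceIn R (E.divPriv T) ≤ noiseSpace R (X + T + 7) := by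
  intro g hg
  obtain ⟨v, hv, hvg⟩ := mem_RRSpace_divPriv.mp hg
  refine mem_noiseSpace.mpr ⟨E.y * v, poleSpace_mono (by omega)
    (mul_mem_poleSpace y_mem_poleSpace hv), ?_⟩
  rw [map_mul, hvg]; rfl

namespace InterpPoints

variable {J : ℕ} (I : E.InterpPoints J)

theorem den_mem_nonvanishing (hx : ∀ i j, (R i).1.1 ≠ I.α j) :
    algebraMap F[X] E.CoordRing I.den ∈ nonvanishing R := by
  refine ⟨fun h => I.den_ne_zero (FaithfulSMul.algebraMap_eq_zero_iff _ _ |>.mp h), fun i => ?_⟩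
  rw [AffinePoint.eval_algebraMap]
  exact I.eval_den_ne_zero (hx i)

theorem num_mem_nonvanishing (hx : ∀ i j, (R i).1.1 ≠ I.α j) (hy : ∀ i, (R i).1.2 ≠ 0)
    (ℓ : Fin J ⊕ Fin (J - 1)) : I.num ℓ ∈ nonvanishing R := by
  constructor
  · intro h
    have h1 := I.interp_mul_den ℓ
    rw [h, map_zero] at h1
    exact mul_ne_zero (I.interp_ne_zero ℓ) I.toField_den_ne_zero h1
  · intro i
    have hne (j : Fin J) : (X - C (I.α j)).eval (R i).1.1 ≠ 0 := by
      simpa [sub_eq_zero] using hx i j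
    rcases ℓ with j | j
    · change (R i).eval (E.ofPair (I.num1 j, 0)) ≠ 0
      rw [AffinePoint.eval_ofPair, eval_zero, zero_mul, add_zero, num1, eval_prod]
      exact Finset.prod_ne_zero_iff.mpr fun j' _ => hne j'
    · change (R i).eval (E.ofPair (0, I.num2 j)) ≠ 0
      rw [AffinePoint.eval_ofPair, eval_zero, zero_add, num2, eval_prod]
      exact mul_ne_zero (Finset.prod_ne_zero_iff.mpr fun j' _ => hne _) (hy i)

theorem exists_unit (hx : ∀ i j, (R i).1.1 ≠ I.α j) (hy : ∀ i, (R i).1.2 ≠ 0)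
    (ℓ : Fin J ⊕ Fin (J - 1)) :
    ∃ h : (regularAlg R)ˣ, ((h : regularAlg R) : E.FunField) = I.interp ℓ := by
  have h1 : I.interp ℓ ∈ regularAlg R :=
    mem_regularAlg (I.den_mem_nonvanishing hx) (I.interp_mul_den ℓ)
  have h2 : (I.interp ℓ)⁻¹ ∈ regularAlg R :=
    mem_regularAlg (u := algebraMap F[X] E.CoordRing I.den) (I.num_mem_nonvanishing hx hy ℓ)
      (by rw [← interp_mul_den, inv_mul_cancel_left₀ (I.interp_ne_zero ℓ)])
  exact ⟨⟨⟨_, h1⟩, ⟨_, h2⟩, Subtype.ext (mul_inv_cancel₀ (I.interp_ne_zero ℓ)),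
    Subtype.ext (inv_mul_cancel₀ (I.interp_ne_zero ℓ))⟩, rfl⟩

theorem RRSpace_divSec_le (hx : ∀ i j, (R i).1.1 ≠ I.α j) (hy : ∀ i, (R i).1.2 ≠ 0) (X : ℕ)
    (ℓ : Fin J ⊕ Fin (J - 1)) : E.RRSpace (I.divSec X ℓ) ≤ (regularAlg R).toSubmodule := by
  intro g hg
  obtain ⟨u, -, hu⟩ := I.mem_RRSpace_divSec.mp hg
  refine mem_regularAlg (u := u * algebraMap F[X] E.CoordRing I.den)
    (I.num_mem_nonvanishing hx hy ℓ) ?_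
  rw [← interp_mul_den, ← mul_assoc, ← hu, map_mul]

/-- Interpolate the values t n · h_ℓ(R n) by a function in ℒ((X + 1) P∞), then divide by the unit
h_ℓ. -/
theorem exists_mem_divSec_evalMap_eq (hR : Function.Injective R) {X : ℕ}
    {ℓ : Fin J ⊕ Fin (J - 1)} {h : (regularAlg R)ˣ}
    (hh : ((h : regularAlg R) : E.FunField) = I.interp ℓ) (S : Finset (Fin N)) (hS : S.card ≤ X)
    (t : Fin N → F) : ∃ δ ∈ RRSpaceIn R (I.divSec X ℓ), ∀ n ∈ S, evalMap R δ n = t n := by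
  obtain ⟨u, hu, hut⟩ := exists_mem_poleSpace_eval_eq (Q := fun n : S => R n)
    (hR.comp Subtype.val_injective) (n := X + 1) (by simpa using Nat.lt_succ_of_le hS)
    (fun n => t n * evalMap R h n)
  have e : algebraMap E.CoordRing (regularAlg R) u * (h⁻¹ : (regularAlg R)ˣ) * h =
      algebraMap E.CoordRing (regularAlg R) u := Units.inv_mul_cancel_right _ _
  refine ⟨algebraMap E.CoordRing (regularAlg R) u * (h⁻¹ : (regularAlg R)ˣ),
    I.mem_RRSpace_divSec.mpr ⟨u, hu, ?_⟩, fun n hn => ?_⟩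
  · rw [← hh]
    exact (congrArg Subtype.val e).symm
  · have h0 : evalMap R h n ≠ 0 :=
      ((h.isUnit.map (evalMap R)).map (Pi.evalRingHom _ n)).ne_zero
    apply mul_right_cancel₀ h0
    rw [← Pi.mul_apply, ← map_mul, e, evalMap_algebraMap]
    exact hut ⟨n, hn⟩

/-- Multiplication by y and the common denominator turns the function into `u`. Its signal part has
pole order at most 3 + (2J - 1) and its noise part at most 2J + m, so `hinj` gives u = 0. At P_j and
P̄_j the denominator vanishes and y does not, which isolates the signal. -/
theorem eq_zero_of_evalMap_eq_zero {m : ℕ} (hm : 3 ≤ m) (hN : N = 2 * J + m)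
    (hinj : ∀ u ∈ E.poleSpace N, (∀ n, (R n).eval u = 0) → u = 0)
    {h : Fin J ⊕ Fin (J - 1) → regularAlg R}
    (hh : ∀ ℓ, ((h ℓ : regularAlg R) : E.FunField) = I.interp ℓ)
    {c : Fin J ⊕ Fin (J - 1) → F} {v : regularAlg R} (hv : v ∈ noiseSpace R m)
    (h0 : evalMap R (∑ ℓ, c ℓ • h ℓ + v) = 0) : c = 0 := by
  obtain ⟨w, hw, hwv⟩ := mem_noiseSpace.mp hv
  set u := E.y * ∑ ℓ, c ℓ • I.num ℓ + algebraMap F[X] E.CoordRing I.den * w with hu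
  have hcoe : ((∑ ℓ, c ℓ • h ℓ + v : regularAlg R) : E.FunField) =
      ∑ ℓ, c ℓ • I.interp ℓ + v := by
    simp [hh]
  have hu0 : u = 0 := by
    refine hinj u (Submodule.add_mem _ ?_ ?_) fun n => ?_
    · refine poleSpace_mono (show 3 + (2 * J - 1) ≤ N by omega)
        (mul_mem_poleSpace y_mem_poleSpace (Submodule.sum_mem _ fun ℓ _ => ?_))
      exact Submodule.smul_mem _ _ (I.num_mem_poleSpace ℓ)
    · rw [hN]
      exact mul_mem_poleSpace (algebraMap_mem_poleSpace (by rw [natDegree_den])) hw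
    · rw [← evalMap_mul_eval (g := ∑ ℓ, c ℓ • h ℓ + v)
        (v := E.y * algebraMap F[X] E.CoordRing I.den), h0, Pi.zero_apply, zero_mul]
      rw [hcoe, hu, map_add, map_mul, map_mul, map_mul, hwv, ← sum_interp_mul_den]
      ring
  have key (P : E.AffinePoint) (hP : I.den.eval P.1.1 = 0) (hPy : P.1.2 ≠ 0) :
      P.eval (∑ ℓ, c ℓ • I.num ℓ) = 0 := by
    have h1 : P.eval u = 0 := by rw [hu0, map_zero]
    rw [hu, map_add, map_mul, map_mul, P.eval_y, P.eval_algebraMap, hP, zero_mul,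
      add_zero] at h1
    exact (mul_eq_zero.mp h1).resolve_left hPy
  exact I.eq_zero_of_eval_sum_num
    (fun j => key (I.P j) (I.eval_den_α j) (I.β_ne_zero j))
    (fun j => key (I.Pbar j) (I.eval_den_α j) (neg_ne_zero.mpr (I.β_ne_zero j)))

theorem divSec_mul_interp_mem_noiseSpace {X T : ℕ} {ℓ : Fin J ⊕ Fin (J - 1)} {h f : regularAlg R}
    (hh : (h : E.FunField) = I.interp ℓ) (hf : f ∈ RRSpaceIn R (I.divSec X ℓ)) :
    f * h ∈ noiseSpace R (X + T + 7) := by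
  obtain ⟨v, hv, hvf⟩ := I.mem_RRSpace_divSec.mp hf
  refine mem_noiseSpace.mpr ⟨E.y * v, poleSpace_mono (by omega)
    (mul_mem_poleSpace y_mem_poleSpace hv), ?_⟩
  rw [map_mul, hvf, ← hh]; rfl

theorem divSec_mul_divPriv_mem_noiseSpace {X T : ℕ} {ℓ : Fin J ⊕ Fin (J - 1)} {f g : regularAlg R}
    (hf : f ∈ RRSpaceIn R (I.divSec X ℓ)) (hg : g ∈ RRSpaceIn R (E.divPriv T)) :
    f * g ∈ noiseSpace R (X + T + 7) := by
  obtain ⟨u, hu, huf⟩ := I.mem_RRSpace_divSec.mp hf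
  obtain ⟨v, hv, hvg⟩ := mem_RRSpace_divPriv.mp hg
  obtain ⟨r, hr, hry⟩ := I.exists_mul_interp_eq_y ℓ
  -- y f g = (y / h_ℓ)(f h_ℓ) g has pole order at most 5 + (X + 1) + (T + 1), which fixes the
  -- constant 7.
  refine mem_noiseSpace.mpr ⟨r * u * v, poleSpace_mono (by omega)
    (mul_mem_poleSpace (mul_mem_poleSpace hr hu) hv), ?_⟩
  rw [map_mul, map_mul, huf, hvg, ← hry, MulMemClass.coe_mul]
  change E.toField r * ((f : E.FunField) * I.interp ℓ) * (g : E.FunField) = _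
  ring

end InterpPoints

/-! ### Choice of the evaluation points. -/

instance [Finite F] : Finite E.AffinePoint :=
  inferInstanceAs (Finite {P : F × F // P.2 ^ 2 = E.f.eval P.1})

variable (E) in
-- At most two points lie over each abscissa; `P∞` and the zeros of y are counted separately.
theorem exists_abscissas [Finite F] : ∃ A : Finset F,
    (∀ a ∈ A, ∃ b : F, b ≠ 0 ∧ b ^ 2 = E.f.eval a) ∧
      E.numPoints ≤ 1 + E.numZerosY + 2 * A.card := by
  classical
  have := Fintype.ofFinite E.AffinePoint
  let s : Finset E.AffinePoint := {P | P.1.2 ≠ 0}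
  let z : Finset E.AffinePoint := {P | P.1.2 = 0}
  refine ⟨s.image fun P => P.1.1, fun a ha => ?_, ?_⟩
  · obtain ⟨P, hP, rfl⟩ := Finset.mem_image.mp ha
    exact ⟨P.1.2, (Finset.mem_filter.mp hP).2, P.2⟩
  have h1 : s.card ≤ 2 * (s.image fun P => P.1.1).card := by
    refine Finset.card_le_mul_card_image _ 2 fun a ha => ?_
    obtain ⟨P, -, rfl⟩ := Finset.mem_image.mp ha
    let P' : E.AffinePoint := ⟨(P.1.1, -P.1.2), (neg_sq P.1.2).trans P.2⟩
    refine (Finset.card_le_card (t := {P, P'}) fun Q hQ => ?_).trans Finset.card_le_two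
    have hx : Q.1.1 = P.1.1 := (Finset.mem_filter.mp hQ).2
    have hy : Q.1.2 ^ 2 = P.1.2 ^ 2 := by rw [Q.2, P.2, hx]
    rw [Finset.mem_insert, Finset.mem_singleton]
    exact (sq_eq_sq_iff_eq_or_eq_neg.mp hy).imp (fun h => Subtype.ext (Prod.ext hx h))
      fun h => Subtype.ext (Prod.ext hx h)
  have h2 : z.card + s.card = Fintype.card E.AffinePoint :=
    Finset.card_filter_add_card_filter_not _
  have h3 : E.numZerosY = z.card := by
    rw [numZerosY, Nat.card_eq_fintype_card, Fintype.card_subtype]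
  rw [numPoints, Finite.card_option, Nat.card_eq_fintype_card, h3]
  omega

/-- Points with prescribed abscissas and conjugates of about half of them: their sum is never zero in
the group of the curve, so no function has its zeros exactly at these points. -/
theorem exists_evaluation_points {A : Finset F}
    (hA : ∀ a ∈ A, ∃ b : F, b ≠ 0 ∧ b ^ 2 = E.f.eval a) {N : ℕ} (hN : 0 < N)
    (hcard : N < 2 * A.card) :
    ∃ R : Fin N → E.AffinePoint, Function.Injective R ∧ (∀ i, (R i).1.1 ∈ A) ∧
      (∀ i, (R i).1.2 ≠ 0) ∧ ∀ u ∈ E.poleSpace N, (∀ i, (R i).eval u = 0) → u = 0 := by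
  choose! b hb0 hb using hA
  -- For N > 0, N / 2 + 1 points and (N - 1) / 2 conjugates make N points, leaving one unpaired if N
  -- is odd and two if N is even. With N even and all points paired, ∏ (x - a) would be a nonzero
  -- function in ℒ(N P∞) vanishing at all of them.
  obtain ⟨e⟩ := Function.Embedding.nonempty_of_card_le (α := Fin (N / 2 + 1)) (β := A)
    (by simp only [Fintype.card_fin, Fintype.card_coe]; omega)
  have hle : (N - 1) / 2 ≤ N / 2 + 1 := by omega
  let ι : Fin ((N - 1) / 2) → Fin (N / 2 + 1) := Fin.castLE hle
  let P (i : Fin (N / 2 + 1)) : E.AffinePoint := ⟨((e i).1, b (e i).1), hb _ (e i).2⟩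
  let P' (i : Fin ((N - 1) / 2)) : E.AffinePoint :=
    ⟨((e (ι i)).1, -b (e (ι i)).1), (neg_sq _).trans (hb _ (e (ι i)).2)⟩
  have ha : Function.Injective fun i => (e i).1 := Subtype.val_injective.comp e.injective
  have hι : Function.Injective ι := Fin.castLE_injective hle
  let E' : Fin N ≃ Fin (N / 2 + 1) ⊕ Fin ((N - 1) / 2) :=
    (finCongr (by omega)).trans finSumFinEquiv.symm
  have hinj : Function.Injective (Sum.elim P P') := by
    refine Function.Injective.sumElim (fun i j h => ha (congrArg (fun Q => Q.1.1) h))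
      (fun i j h => hι (ha (congrArg (fun Q => Q.1.1) h))) fun i j h => ?_
    have h1 : i = ι j := ha (congrArg (fun Q => Q.1.1) h)
    have h2 : b (e i).1 = -b (e (ι j)).1 := congrArg (fun Q => Q.1.2) h
    rw [h1] at h2
    have h3 : 2 * b (e (ι j)).1 = 0 := by linear_combination h2
    exact mul_ne_zero E.two_ne_zero_field (hb0 _ (e (ι j)).2) h3
  refine ⟨Sum.elim P P' ∘ E', hinj.comp E'.injective, fun i => ?_, fun i => ?_, fun u hu h => ?_⟩
  · rw [Function.comp_apply]
    rcases E' i with j | j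
    · exact (e j).2
    · exact (e (ι j)).2
  · rw [Function.comp_apply]
    rcases E' i with j | j
    · exact hb0 _ (e j).2
    · exact neg_ne_zero.mpr (hb0 _ (e (ι j)).2)
  · have h' (j) : (Sum.elim P P' j).eval u = 0 := by
      have := h (E'.symm j)
      rwa [Function.comp_apply, E'.apply_symm_apply] at this
    exact eq_zero_of_eval_eq_zero (Nat.lt_succ_self _) le_rfl hu ha hι
      (fun i => hb0 _ (e (ι i)).2) (fun _ => rfl) (fun _ => rfl) (fun i => h' (.inl i))
      (fun i => h' (.inr i))

end EllipticCurve

end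

/-! ### The main theorem. -/

theorem mainTheorem3 {F : Type u} [Field F] [Finite F] (E : EllipticCurve F)
    (L X T J Z N : ℕ) (hL : Odd L) (hJ : J = (L + 1) / 2) (hZ : Z = E.numZerosY)
    (hN : N = L + X + T + 8) (hE : 2 * L + X + T + 11 + Z ≤ E.numPoints) :
    Nonempty (E.InterpPoints J) ∧
    ∀ I : E.InterpPoints J,
      -- the functions `h_ℓ` form a basis of `ℒ(D^info)`
      (LinearIndependent F I.interp ∧
        Submodule.span F (Set.range I.interp) = E.RRSpace I.divInfo) ∧
      -- there are `N` evaluation points off the `P j`, `P̄ j`, `P∞` and the zeros of `y`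
      ∃ R : Fin N → E.AffinePoint, Function.Injective R ∧
        (∀ i j, R i ≠ I.P j ∧ R i ≠ I.Pbar j) ∧ (∀ i, (R i).1.2 ≠ 0) ∧
        -- the `h_ℓ` are units of the algebra `A`
        ∃ h : Fin J ⊕ Fin (J - 1) → (EllipticCurve.regularAlg R)ˣ,
          (∀ ℓ, ((h ℓ : EllipticCurve.regularAlg R) : E.FunField) = I.interp ℓ) ∧
          -- the encoding, query, security and privacy spaces
          E.RRSpace 0 = Submodule.span F {1} ∧
          (∀ ℓ, E.RRSpace (I.divQuery ℓ) = Submodule.span F {I.interp ℓ}) ∧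
          (∀ ℓ, Module.finrank F (E.RRSpace (I.divSec X ℓ)) = X + 1) ∧
          Module.finrank F (E.RRSpace (E.divPriv T)) = T + 1 ∧
          (∀ ℓ, E.RRSpace (I.divSec X ℓ) ≤ (EllipticCurve.regularAlg R).toSubmodule) ∧
          E.RRSpace (E.divPriv T) ≤ (EllipticCurve.regularAlg R).toSubmodule ∧
          -- the resulting scheme, for any number `M` of files
          ∀ M : ℕ,
            let S : PIRScheme (Fin J ⊕ Fin (J - 1) → F) M N :=
              PIRScheme.ofAlgebra M (Algebra.linearMap F (EllipticCurve.regularAlg R))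
                (fun ℓ => EllipticCurve.RRSpaceIn R (I.divSec X ℓ)) (fun ℓ => h ℓ)
                (fun _ => EllipticCurve.RRSpaceIn R (E.divPriv T)) (EllipticCurve.evalMap R)
            S.IsSecurePrivate X T ∧ S.rate = (L : ℝ) / N ∧
              S.rate = 1 - ((X : ℝ) + T + 8) / N := by
  have hJ0 : 0 < J := by obtain ⟨k, rfl⟩ := hL; omega
  have hLJ : L = 2 * J - 1 := by obtain ⟨k, rfl⟩ := hL; omega
  obtain ⟨A, hA, hcard⟩ := E.exists_abscissas
  refine ⟨?_, fun I => ⟨⟨I.linearIndependent_interp, I.span_interp hJ0⟩, ?_⟩⟩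
  · choose! b hb0 hb using hA
    obtain ⟨e⟩ := Function.Embedding.nonempty_of_card_le (α := Fin J) (β := A)
      (by simp only [Fintype.card_fin, Fintype.card_coe]; omega)
    exact ⟨⟨fun j => (e j).1, fun j => b (e j).1, fun j => hb _ (e j).2, fun j => hb0 _ (e j).2,
      Subtype.val_injective.comp e.injective⟩⟩
  classical
  -- The point count gives 2 |A| ≥ 2L + X + T + 10. Removing the J abscissas of the P_j costs 2J = L
  -- + 1, which leaves L + X + T + 9 = N + 1.
  have hcard' : N < 2 * (A \ Finset.univ.image I.α).card := by
    have h1 := Finset.le_card_sdiff (Finset.univ.image I.α) A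
    have h2 : (Finset.univ.image I.α).card = J := by
      rw [Finset.card_image_of_injective _ I.α_injective, Finset.card_univ, Fintype.card_fin]
    omega
  obtain ⟨R, hR, hRA, hy, hinj⟩ := EllipticCurve.exists_evaluation_points
    (fun a ha => hA a (Finset.mem_sdiff.mp ha).1) (by omega) hcard'
  have hx (i j) : (R i).1.1 ≠ I.α j := fun h =>
    (Finset.mem_sdiff.mp (hRA i)).2 (Finset.mem_image.mpr ⟨j, Finset.mem_univ j, h.symm⟩)
  choose h hh using I.exists_unit hx hy
  refine ⟨R, hR, fun i j => ⟨fun e => hx i j (congrArg (fun Q => Q.1.1) e),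
    fun e => hx i j (congrArg (fun Q => Q.1.1) e)⟩, hy, h, hh, EllipticCurve.RRSpace_zero,
    fun ℓ => EllipticCurve.RRSpace_neg_div (I.interp_ne_zero ℓ), I.finrank_RRSpace_divSec X,
    EllipticCurve.finrank_RRSpace_divPriv T, I.RRSpace_divSec_le hx hy X,
    EllipticCurve.RRSpace_divPriv_le T, fun M => ?_⟩
  intro S
  have hfs (ℓ) : Finite (EllipticCurve.RRSpaceIn R (I.divSec X ℓ)) :=
    EllipticCurve.finite_RRSpaceIn (by rw [I.finrank_RRSpace_divSec]; exact X.succ_pos)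
  have hfp : Finite (EllipticCurve.RRSpaceIn R (E.divPriv T)) :=
    EllipticCurve.finite_RRSpaceIn (by
      rw [EllipticCurve.finrank_RRSpace_divPriv]; exact T.succ_pos)
  have hrate : S.rate = (L : ℝ) / N := by
    refine PIRScheme.rate_ofAlgebra.trans ?_
    rw [Fintype.card_sum, Fintype.card_fin, Fintype.card_fin, show J + (J - 1) = L by omega]
  refine ⟨?_, hrate, ?_⟩
  · refine
      { finite_storeRand := inferInstanceAs
          (Finite ((ℓ : Fin J ⊕ Fin (J - 1)) → Fin M → EllipticCurve.RRSpaceIn R (I.divSec X ℓ)))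
        nonempty_storeRand := ⟨fun _ _ => 0⟩
        finite_queryRand := inferInstanceAs
          (Finite (Fin J ⊕ Fin (J - 1) → Fin M → EllipticCurve.RRSpaceIn R (E.divPriv T)))
        nonempty_queryRand := ⟨fun _ _ => 0⟩
        finite_answer := ‹Finite F›
        correct := ?_
        secure := PIRScheme.isSecure_ofAlgebra fun s hs ℓ =>
          I.exists_mem_divSec_evalMap_eq hR (hh ℓ) s hs
        priv := PIRScheme.isPrivate_ofAlgebra fun s hs _ =>
          EllipticCurve.exists_mem_divPriv_evalMap_eq hR s hs }
    -- Since L = 2J - 1, the number of servers is N = 2J + (X + T + 7), as decoding requires.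
    exact PIRScheme.isCorrect_ofAlgebra (EllipticCurve.noiseSpace R (X + T + 7))
      (fun _ => EllipticCurve.divPriv_le_noiseSpace X T)
      (fun ℓ _ hf => I.divSec_mul_interp_mem_noiseSpace (hh ℓ) hf)
      (fun _ _ hf _ hg => I.divSec_mul_divPriv_mem_noiseSpace hf hg)
      (fun _ _ hv h0 => I.eq_zero_of_evalMap_eq_zero (by omega) (by omega) hinj hh hv h0)
  · have hN0 : (N : ℝ) ≠ 0 := by
      have : N ≠ 0 := by omega
      exact_mod_cast this
    rw [hrate, eq_sub_iff_add_eq, ← add_div, div_eq_one_iff_eq hN0, hN]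
    push_cast
    ring
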